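/- Let $\delta,\kappa>0$ with $\delta/2>\kappa$. An $m\times n$ bipartite graph with left vertices $[m]$ and right vertices $[n]$ is called $(\delta,\kappa)$-broadly connected if (i) every right vertex has degree at least $\delta m$; (ii) every left vertex has degree at least $\delta n$; (iii) for every $J\subset[m]$, the set $$I(J)=\{i\in[n] : i \text{ is connected to at least } \lfloor(\delta/2)|J|\rfloor \text{ vertices } j\in J\}$$ satisfies $|I(J)|\ge\min\big((1+\kappa)|J|,\,n\big)$. For a matrix $A=(a_{i,j})$ let $\Gamma_A$ be the bipartite graph between the rows (left vertices) and the columns (right vertices) of $A$ in which row $j$ is connected to column $i$ whenever $a_{j,i}\ne0$. Theorem. Let $\delta,\kappa>0$ with $\delta/2>\kappa$, and let $r>0$. There exist constants $c,C,c'>0$ and $n_0\in\mathbb N$, depending only on $\delta,\kappa,r$, such that the following holds for all $n\ge n_0$. Let $W$ be an $n\times n$ random matrix with independent normal entries $w_{i,j}\sim N(b_{i,j},a_{i,j}^2)$ (a normal variable of variance $0$ being constant), and assume that 1. $a_{i,j}\in\{0\}\cup[r,1]$ for all $i,j$; 2. the graph $\Gamma_A$ of $A=(a_{i,j})$ is $(\delta,\kappa)$-broadly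 connected; 3. $\|\mathbb E W\|\le K\sqrt n$ for some $K\ge1$, where $\|\cdot\|$ is the Euclidean operator norm. Then for every $t>0$ the smallest singular value $s_n(W)$ satisfies $$\mathbb P\big(s_n(W)\le c\,t\,K^{-C}\,n^{-1/2}\big)\le t+e^{-c'n}.$$ -/

import Mathlib

open MeasureTheory ProbabilityTheory

/-- An `m × n` bipartite graph with left vertices `Fin m`, right vertices `Fin n`, and edge set
given by the relation `Adj j i` (written `j → i`: the left vertex `j` is connected to the right
vertex `i`). -/
structure BipGraph (m n : ℕ) where
  Adj : Fin m → Fin n → Prop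

namespace BipGraph

variable {m n : ℕ}

open Classical in
/-- The degree of a right vertex. -/
noncomputable def rightDegree (Γ : BipGraph m n) (i : Fin n) : ℕ :=
  (Finset.univ.filter fun j : Fin m => Γ.Adj j i).card

open Classical in
/-- The degree of a left vertex. -/
noncomputable def leftDegree (Γ : BipGraph m n) (j : Fin m) : ℕ :=
  (Finset.univ.filter fun i : Fin n => Γ.Adj j i).card

open Classical in
/-- The set `I(J)` of broadly connected neighbours of a set `J` of left vertices: the right
vertices connected to at least `⌊(δ/2)|J|⌋` elements of `J`. -/
noncomputable def broadNeighbors (Γ : BipGraph m n) (δ : ℝ) (J : Finset (Fin m)) :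
    Finset (Fin n) :=
  Finset.univ.filter fun i : Fin n =>
    ⌊(δ / 2) * (J.card : ℝ)⌋₊ ≤ (J.filter fun j => Γ.Adj j i).card

/-- `(δ, κ)`-broadly connected bipartite graphs (used for `δ, κ > 0`, `δ / 2 > κ`). -/
structure BroadlyConnected (Γ : BipGraph m n) (δ κ : ℝ) : Prop where
  rightDegree_ge : ∀ i : Fin n, δ * (m : ℝ) ≤ (Γ.rightDegree i : ℝ)
  leftDegree_ge : ∀ j : Fin m, δ * (n : ℝ) ≤ (Γ.leftDegree j : ℝ)
  expansion : ∀ J : Finset (Fin m),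
    min ((1 + κ) * (J.card : ℝ)) (n : ℝ) ≤ ((Γ.broadNeighbors δ J).card : ℝ)

/-- The bipartite graph of a matrix: the row `j` is connected to the column `i` whenever
`A j i ≠ 0`. -/
def ofMatrix (A : Matrix (Fin m) (Fin n) ℝ) : BipGraph m n where
  Adj j i := A j i ≠ 0

end BipGraph

/-- The operator norm of a square real matrix with respect to the Euclidean norm. -/
noncomputable def euclideanOpNorm {n : ℕ} (B : Matrix (Fin n) (Fin n) ℝ) : ℝ :=
  ‖Matrix.toEuclideanCLM (n := Fin n) (𝕜 := ℝ) B‖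

/-- The smallest singular value `s_n(W)` of an `n × n` real matrix. (Mathlib's singular values are
in decreasing order and indexed from zero.) -/
noncomputable def smallestSingularValue {n : ℕ} (W : Matrix (Fin n) (Fin n) ℝ) : ℝ :=
  (Matrix.toEuclideanLin W).singularValues (n - 1)

/-- The entrywise expectation `𝔼 W` of a random matrix. -/
noncomputable def matrixExpectation {Ω : Type*} [MeasurableSpace Ω] (μ : Measure Ω) {n : ℕ}
    (W : Ω → Matrix (Fin n) (Fin n) ℝ) : Matrix (Fin n) (Fin n) ℝ :=
  Matrix.of fun i j => ∫ ω, W ω i j ∂μ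

/-- `W` is a random matrix whose entries are independent normal variables
`W i j ∼ N(b i j, (a i j)²)`. A normal variable of variance `0` is a constant. -/
structure HasIndepNormalEntries {Ω : Type*} [MeasurableSpace Ω] (μ : Measure Ω) {n : ℕ}
    (W : Ω → Matrix (Fin n) (Fin n) ℝ) (b a : Matrix (Fin n) (Fin n) ℝ) : Prop where
  hasLaw : ∀ i j : Fin n,
    HasLaw (fun ω => W ω i j) (gaussianReal (b i j) ⟨a i j ^ 2, sq_nonneg (a i j)⟩) μ
  indep : iIndepFun (fun (p : Fin n × Fin n) (ω : Ω) => W ω p.1 p.2) μ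

/-! Let `x` be a unit vector with `‖W x‖ = s_n(W)`. If `ν` is a unit normal to all columns but the
`k`-th, then `⟨ν, W x⟩ = x_k ⟨ν, W_k⟩`, so `|⟨ν, W_k⟩| ≤ s_n(W) / |x_k|`. The normal `ν` can be
chosen from the other columns, so it is independent of `W_k`, and `⟨ν, W_k⟩` has a bounded density
once `ν` has enough mass on the support of column `k` of `A`. If `x` has `αn` coordinates of order
at least `n^(-1/2)`, then `αn` of these `n` unlikely events occur at once; Markov's inequality for
their number avoids the factor `n` of a union bound (`gaussMat_card_nearNormal`,
`le_ncard_nearNormal`).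

It remains to show spread: `αn` large coordinates for `x`, and `(1 - δ/2)n` for `ν`, so that `ν`
meets every column support in `δn/2` places. Round a vector towards zero to multiples of `ρ/√n`, and
let `J` be the support of the result. Up to exponential factors there are `ρ^(-|J|)` such lattice
vectors, and each has a small image on a set `S` of rows whose linear forms have variance at least
`s²` with probability `(Lρ/s)^|S|`. If `|S| ≥ |J| + ηn`, the powers of `ρ` cancel except for
`ρ^(ηn)`, which beats all exponential factors when `ρ` is small (`gaussMat_latticeBad`). Hence an
almost annihilated vector cannot have noticeably more high-variance rows than large coordinates.

The degree condition supplies a fixed proportion of high-variance rows, hence `αn` large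
coordinates. Broad connectedness then supplies `(1 + κ)|J|` such rows, so lowering the threshold
multiplies the number of large coordinates by `1 + κ/2`; boundedly many rounds reach `(1 - δ/2)n`
(`card_bigCoords_of_notMem_stageBad`). All thresholds are fixed powers of a parameter `L`
proportional to `K`, whence the factor `K^(-C)`. -/

/-- The square of a real number, as a nonnegative real. -/
noncomputable def sqNN (x : ℝ) : NNReal := NNReal.mk (x ^ 2) (sq_nonneg x)

@[simp] lemma coe_sqNN (x : ℝ) : (sqNN x : ℝ) = x ^ 2 := rfl

/-! ### The law of the matrix and of its row forms -/

/-- The law of a random matrix with independent `N (b i j, a i j ^ 2)` entries. -/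
noncomputable def gaussMat {n : ℕ} (b a : Fin n → Fin n → ℝ) : Measure (Fin n → Fin n → ℝ) :=
  Measure.pi fun i => Measure.pi fun j => gaussianReal (b i j) (sqNN (a i j))

instance isProbabilityMeasure_gaussMat {n : ℕ} (b a : Fin n → Fin n → ℝ) : IsProbabilityMeasure (gaussMat b a) := by
  unfold gaussMat; infer_instance

lemma HasIndepNormalEntries.aemeasurable {Ω : Type*} [MeasurableSpace Ω] {μ : Measure Ω} {n : ℕ}
    {W : Ω → Matrix (Fin n) (Fin n) ℝ} {b a : Matrix (Fin n) (Fin n) ℝ}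
    (h : HasIndepNormalEntries μ W b a) :
    AEMeasurable (fun ω i j => W ω i j) μ :=
  aemeasurable_pi_lambda _ fun i => aemeasurable_pi_lambda _ fun j => (h.hasLaw i j).aemeasurable

lemma HasIndepNormalEntries.map_entry {Ω : Type*} [MeasurableSpace Ω] {μ : Measure Ω} {n : ℕ}
    {W : Ω → Matrix (Fin n) (Fin n) ℝ} {b a : Matrix (Fin n) (Fin n) ℝ}
    (h : HasIndepNormalEntries μ W b a) (i j : Fin n) :
    μ.map (fun ω => W ω i j) = gaussianReal (b i j) (sqNN (a i j)) :=
  (h.hasLaw i j).map_eq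

lemma pi_gaussianReal_eq_map_uncurry {n : ℕ} (b a : Fin n → Fin n → ℝ) :
    (Measure.pi fun p : Fin n × Fin n => gaussianReal (b p.1 p.2) (sqNN (a p.1 p.2))) =
      (gaussMat b a).map Function.uncurry := by
  refine (Measure.pi_eq fun s hs => ?_)
  rw [Measure.map_apply measurable_uncurry (MeasurableSet.univ_pi hs)]
  have : (Function.uncurry ⁻¹' Set.univ.pi s : Set (Fin n → Fin n → ℝ)) =
      Set.univ.pi fun i => Set.univ.pi fun j => s (i, j) := by
    ext M; simp [Set.mem_pi]
  rw [this, Fintype.prod_prod_type, gaussMat, Measure.pi_pi]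
  exact Finset.prod_congr rfl fun i _ => Measure.pi_pi _ _

lemma HasIndepNormalEntries.map_eq {Ω : Type*} [MeasurableSpace Ω] {μ : Measure Ω} {n : ℕ}
    {W : Ω → Matrix (Fin n) (Fin n) ℝ} {b a : Matrix (Fin n) (Fin n) ℝ}
    (h : HasIndepNormalEntries μ W b a) :
    μ.map (fun ω i j => W ω i j) = gaussMat b a := by
  have h1 := h.indep.map_fun_eq_pi_map fun p : Fin n × Fin n => (h.hasLaw p.1 p.2).aemeasurable
  have h2 := pi_gaussianReal_eq_map_uncurry b a
  have h3 : (fun p : Fin n × Fin n => μ.map fun ω => W ω p.1 p.2) = fun p =>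
      gaussianReal (b p.1 p.2) (sqNN (a p.1 p.2)) :=
    funext fun p => h.map_entry p.1 p.2
  rw [h3, h2] at h1
  have h4 := congrArg (Measure.map Function.curry) h1
  rw [Measure.map_map measurable_curry measurable_uncurry, AEMeasurable.map_map_of_aemeasurable
    measurable_curry.aemeasurable
    (aemeasurable_pi_lambda _ fun p => (h.hasLaw p.1 p.2).aemeasurable)] at h4
  have h5 : (Function.curry ∘ Function.uncurry : (Fin n → Fin n → ℝ) → (Fin n → Fin n → ℝ)) = id := by
    ext; rfl
  rw [h5, Measure.map_id] at h4
  exact h4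

lemma HasIndepNormalEntries.transpose {Ω : Type*} [MeasurableSpace Ω] {μ : Measure Ω} {n : ℕ}
    {W : Ω → Matrix (Fin n) (Fin n) ℝ} {b a : Matrix (Fin n) (Fin n) ℝ}
    (h : HasIndepNormalEntries μ W b a) :
    HasIndepNormalEntries μ (fun ω => (W ω).transpose) b.transpose a.transpose where
  hasLaw i j := h.hasLaw j i
  indep := h.indep.precomp (g := Prod.swap) Prod.swap_injective

lemma HasIndepNormalEntries.matrixExpectation_eq {Ω : Type*} [MeasurableSpace Ω] {μ : Measure Ω}
    {n : ℕ} {W : Ω → Matrix (Fin n) (Fin n) ℝ} {b a : Matrix (Fin n) (Fin n) ℝ}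
    (h : HasIndepNormalEntries μ W b a) : matrixExpectation μ W = b := by
  ext i j
  simp only [matrixExpectation, Matrix.of_apply]
  rw [← integral_id_gaussianReal (μ := b i j) (v := sqNN (a i j)), ← h.map_entry i j,
    integral_map (h.hasLaw i j).aemeasurable (by fun_prop)]

/-- A linear form in independent normal variables is normal. -/
lemma map_linearForm_pi_gaussianReal {n : ℕ} (m : Fin n → ℝ) (v : Fin n → NNReal) (y : Fin n → ℝ) :
    (Measure.pi fun j => gaussianReal (m j) (v j)).map (fun x => ∑ j, x j * y j) =
      gaussianReal (∑ j, m j * y j) (∑ j, v j * sqNN (y j)) := by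
  set P := Measure.pi fun j => gaussianReal (m j) (v j) with hP
  have hlaw : ∀ j, P.map (fun x : Fin n → ℝ => x j * y j) =
      gaussianReal (m j * y j) (v j * sqNN (y j)) := by
    intro j
    have h1 : P.map (fun x : Fin n → ℝ => x j) = gaussianReal (m j) (v j) :=
      (measurePreserving_eval _ j).map_eq
    have h2 := gaussianReal_map_mul_const (μ := m j) (v := v j) (y j)
    rw [← h1, Measure.map_map (by fun_prop) (by fun_prop)] at h2
    rw [mul_comm (m j), mul_comm (v j)]
    exact h2
  have hind : iIndepFun (fun j (x : Fin n → ℝ) => x j * y j) P :=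
    iIndepFun_pi (X := fun j t => t * y j) fun j => by fun_prop
  have key : ∀ s : Finset (Fin n), P.map (∑ j ∈ s, fun x : Fin n → ℝ => x j * y j) =
      gaussianReal (∑ j ∈ s, m j * y j) (∑ j ∈ s, v j * sqNN (y j)) := by
    intro s
    induction s using Finset.cons_induction with
    | empty =>
      simp only [Finset.sum_empty, gaussianReal_zero_var]
      have : (0 : (Fin n → ℝ) → ℝ) = fun _ => 0 := rfl
      rw [this, Measure.map_const]; simp
    | cons j s hj ih =>
      rw [Finset.sum_cons, Finset.sum_cons, Finset.sum_cons]
      refine gaussianReal_add_gaussianReal_of_indepFun ?_ (hlaw j) ih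
      exact (hind.indepFun_finsetSum_of_notMem (fun j => by fun_prop) hj).symm
  have := key Finset.univ
  convert this using 2
  ext x; simp

lemma iIndepFun_row_linearForm {n : ℕ} (b a : Fin n → Fin n → ℝ) (y : Fin n → ℝ) :
    iIndepFun (fun i (M : Fin n → Fin n → ℝ) => ∑ j, M i j * y j) (gaussMat b a) :=
  iIndepFun_pi (X := fun _ (x : Fin n → ℝ) => ∑ j, x j * y j) fun i =>
    Measurable.aemeasurable (by fun_prop)

lemma map_row_linearForm {n : ℕ} (b a : Fin n → Fin n → ℝ) (y : Fin n → ℝ) (i : Fin n) :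
    (gaussMat b a).map (fun M => ∑ j, M i j * y j) =
      gaussianReal (∑ j, b i j * y j) (∑ j, sqNN (a i j) * sqNN (y j)) := by
  rw [← map_linearForm_pi_gaussianReal,
    ← (measurePreserving_eval (fun i => Measure.pi fun j =>
        gaussianReal (b i j) (sqNN (a i j))) i).map_eq,
    Measure.map_map (by fun_prop) (by fun_prop)]
  rfl

/-! ### Small ball estimates -/

/-- Whatever the mean, the density is at most `1 / (√(2π) s)`, and `exp (-x²/ε²)` has integral `√π
ε`. -/
lemma lintegral_exp_neg_sq_gaussianReal_le (m : ℝ) (v : NNReal) {s ε : ℝ} (hs : 0 < s)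
    (hsv : s ^ 2 ≤ v) (hε : 0 < ε) :
    ∫⁻ x, ENNReal.ofReal (Real.exp (-(x ^ 2 / ε ^ 2))) ∂gaussianReal m v ≤
      ENNReal.ofReal (ε / s) := by
  have hv0 : (0 : ℝ) < v := lt_of_lt_of_le (by positivity) hsv
  have hv : v ≠ 0 := by rintro rfl; simp at hv0
  rw [gaussianReal_of_var_ne_zero _ hv, lintegral_withDensity_eq_lintegral_mul _
    (measurable_gaussianPDF m v) (by fun_prop)]
  have hb : ∀ x, (gaussianPDF m v * fun x => ENNReal.ofReal (Real.exp (-(x ^ 2 / ε ^ 2)))) x ≤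
      ENNReal.ofReal ((√(2 * Real.pi) * s)⁻¹ * Real.exp (-(1 / ε ^ 2) * x ^ 2)) := by
    intro x
    simp only [Pi.mul_apply, gaussianPDF]
    rw [← ENNReal.ofReal_mul (gaussianPDFReal_nonneg _ _ _)]
    apply ENNReal.ofReal_le_ofReal
    have h1 : gaussianPDFReal m v x ≤ (√(2 * Real.pi) * s)⁻¹ := by
      rw [gaussianPDFReal_def]
      have h2 : Real.exp (-(x - m) ^ 2 / (2 * v)) ≤ 1 :=
        Real.exp_le_one_iff.mpr (div_nonpos_of_nonpos_of_nonneg (by nlinarith [sq_nonneg (x - m)])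
          (by positivity))
      have h3 : √(2 * Real.pi) * s ≤ √(2 * Real.pi * v) := by
        rw [Real.sqrt_mul (by positivity) (v : ℝ)]
        exact mul_le_mul_of_nonneg_left (Real.le_sqrt_of_sq_le hsv) (by positivity)
      calc (√(2 * Real.pi * v))⁻¹ * Real.exp (-(x - m) ^ 2 / (2 * v))
          ≤ (√(2 * Real.pi * v))⁻¹ * 1 := by gcongr
        _ ≤ _ := by rw [mul_one]; gcongr
    have h4 : -(x ^ 2 / ε ^ 2) = -(1 / ε ^ 2) * x ^ 2 := by ring
    rw [h4]
    gcongr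
  refine (lintegral_mono hb).trans ?_
  rw [← ofReal_integral_eq_lintegral_ofReal
    ((integrable_exp_neg_mul_sq (by positivity)).const_mul _)
    (Filter.Eventually.of_forall fun x => by positivity), integral_const_mul, integral_gaussian]
  apply ENNReal.ofReal_le_ofReal
  have : √(Real.pi / (1 / ε ^ 2)) = √Real.pi * ε := by
    rw [div_div_eq_mul_div, div_one, Real.sqrt_mul Real.pi_pos.le, Real.sqrt_sq hε.le]
  rw [this, Real.sqrt_mul (by norm_num), inv_mul_le_iff₀ (by positivity)]
  have h2 : (1 : ℝ) ≤ √2 := Real.one_le_sqrt.mpr (by norm_num)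
  have h3 : √2 * √Real.pi * s * (ε / s) = √2 * (√Real.pi * ε) := by field_simp
  rw [h3]
  nlinarith [show 0 < √Real.pi * ε by have := Real.pi_pos; positivity]

/-- The variance of the `i`-th row linear form. -/
def rowVar {n : ℕ} (a : Fin n → Fin n → ℝ) (y : Fin n → ℝ) (i : Fin n) : ℝ :=
  ∑ j, a i j ^ 2 * y j ^ 2

lemma lintegral_row_eq {n : ℕ} (b a : Fin n → Fin n → ℝ) (y : Fin n → ℝ) (i : Fin n)
    {f : ℝ → ENNReal} (hf : Measurable f) :
    ∫⁻ M : Fin n → Fin n → ℝ, f (∑ j, M i j * y j) ∂gaussMat b a =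
      ∫⁻ x, f x ∂gaussianReal (∑ j, b i j * y j)
        (∑ j, sqNN (a i j) * sqNN (y j)) := by
  rw [← map_row_linearForm, lintegral_map hf (by fun_prop)]

lemma lintegral_row_exp_neg_sq_le {n : ℕ} (b a : Fin n → Fin n → ℝ) (y : Fin n → ℝ) (i : Fin n)
    {s ε : ℝ} (hs : 0 < s) (hv : s ^ 2 ≤ rowVar a y i) (hε : 0 < ε) :
    ∫⁻ M : Fin n → Fin n → ℝ, ENNReal.ofReal (Real.exp (-((∑ j, M i j * y j) ^ 2 / ε ^ 2))) ∂gaussMat b a ≤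
      ENNReal.ofReal (ε / s) := by
  rw [lintegral_row_eq b a y i (f := fun x => ENNReal.ofReal (Real.exp (-(x ^ 2 / ε ^ 2))))
    (by fun_prop)]
  refine lintegral_exp_neg_sq_gaussianReal_le _ _ hs (hv.trans_eq ?_) hε
  simp [rowVar]

lemma lintegral_prod_rows {n : ℕ} (b a : Fin n → Fin n → ℝ) (y : Fin n → ℝ) (S : Finset (Fin n))
    {f : Fin n → ℝ → ENNReal} (hf : ∀ i, Measurable (f i)) :
    ∫⁻ M : Fin n → Fin n → ℝ, ∏ i ∈ S, f i (∑ j, M i j * y j) ∂gaussMat b a =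
      ∏ i ∈ S, ∫⁻ M : Fin n → Fin n → ℝ, f i (∑ j, M i j * y j) ∂gaussMat b a :=
  lintegral_prod_eq_prod_lintegral_of_indepFun S
    (fun i (M : Fin n → Fin n → ℝ) => f i (∑ j, M i j * y j))
    ((iIndepFun_row_linearForm b a y).comp f hf) fun i => by fun_prop

/-- Tensorized small ball estimate. -/
lemma gaussMat_smallBall {n : ℕ} (b a : Fin n → Fin n → ℝ) (y : Fin n → ℝ) (S : Finset (Fin n))
    {s ε N : ℝ} (hs : 0 < s) (hv : ∀ i ∈ S, s ^ 2 ≤ rowVar a y i) (hε : 0 < ε) :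
    gaussMat b a {M | ∑ i ∈ S, (∑ j, M i j * y j) ^ 2 ≤ ε ^ 2 * N} ≤
      ENNReal.ofReal (Real.exp N * (ε / s) ^ S.card) := by
  set F : (Fin n → Fin n → ℝ) → ENNReal := fun M =>
    ∏ i ∈ S, ENNReal.ofReal (Real.exp (-((∑ j, M i j * y j) ^ 2 / ε ^ 2))) with hF
  have hFm : Measurable F := by fun_prop
  -- Exponential Markov inequality; independence of the rows will factor the expectation of `F`.
  have hsub : {M : Fin n → Fin n → ℝ | ∑ i ∈ S, (∑ j, M i j * y j) ^ 2 ≤ ε ^ 2 * N} ⊆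
      {M | ENNReal.ofReal (Real.exp (-N)) ≤ F M} := by
    intro M hM
    simp only [Set.mem_ofPred_eq] at hM ⊢
    rw [hF]
    simp only
    rw [← ENNReal.ofReal_prod_of_nonneg (fun i _ => (Real.exp_pos _).le), ← Real.exp_sum]
    apply ENNReal.ofReal_le_ofReal
    apply Real.exp_le_exp.mpr
    rw [Finset.sum_neg_distrib, neg_le_neg_iff, ← Finset.sum_div, div_le_iff₀ (by positivity)]
    linarith
  refine (measure_mono hsub).trans ?_
  refine (meas_ge_le_lintegral_div hFm.aemeasurable (by simp [Real.exp_pos])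
    ENNReal.ofReal_ne_top).trans ?_
  rw [hF, lintegral_prod_rows b a y S
    (f := fun _ x => ENNReal.ofReal (Real.exp (-(x ^ 2 / ε ^ 2)))) fun _ => by fun_prop]
  have h1 : ∏ i ∈ S, ∫⁻ M : Fin n → Fin n → ℝ, ENNReal.ofReal (Real.exp (-((∑ j, M i j * y j) ^ 2 / ε ^ 2)))
      ∂gaussMat b a ≤ ENNReal.ofReal ((ε / s) ^ S.card) := by
    rw [ENNReal.ofReal_pow (by positivity), ← Finset.prod_const]
    exact Finset.prod_le_prod' fun i hi => lintegral_row_exp_neg_sq_le b a y i hs (hv i hi) hε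
  refine (ENNReal.div_le_div_right h1 _).trans ?_
  rw [← ENNReal.ofReal_div_of_pos (Real.exp_pos _)]
  apply ENNReal.ofReal_le_ofReal
  rw [Real.exp_neg, div_inv_eq_mul, mul_comm]

/-! ### Rounding to a lattice and counting lattice points -/

/-- Rounding of a real number towards zero. -/
noncomputable def truncInt (u : ℝ) : ℤ := if 0 ≤ u then ⌊u⌋ else ⌈u⌉

lemma abs_sub_truncInt_le (u : ℝ) : |u - truncInt u| ≤ 1 := by
  unfold truncInt
  split_ifs with h
  · rw [abs_le]; constructor <;> linarith [Int.floor_le u, Int.lt_floor_add_one u]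
  · rw [abs_le]; constructor <;> linarith [Int.le_ceil u, Int.ceil_lt_add_one u]

lemma abs_truncInt_le (u : ℝ) : |(truncInt u : ℝ)| ≤ |u| := by
  unfold truncInt
  split_ifs with h
  · rw [abs_of_nonneg h, abs_of_nonneg (by exact_mod_cast Int.floor_nonneg.mpr h)]
    exact Int.floor_le u
  · push Not at h
    have h1 : ⌈u⌉ ≤ 0 := Int.ceil_le.mpr (by simpa using h.le)
    rw [abs_of_neg h, abs_of_nonpos (by exact_mod_cast h1)]
    linarith [Int.le_ceil u]

/-- This is the reason for rounding towards zero: the support of the rounded vector is exactly the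
set of large coordinates, so small coordinates cost nothing in the count of lattice points. -/
lemma truncInt_ne_zero_iff (u : ℝ) : truncInt u ≠ 0 ↔ 1 ≤ |u| := by
  constructor
  · intro h
    have h1 : (1 : ℝ) ≤ |(truncInt u : ℝ)| := by exact_mod_cast Int.one_le_abs h
    exact h1.trans (abs_truncInt_le u)
  · intro h h0
    unfold truncInt at h0
    split_ifs at h0 with h1
    · rw [abs_of_nonneg h1] at h
      have := Int.floor_eq_zero_iff.mp h0
      linarith [this.2]
    · push Not at h1
      rw [abs_of_neg h1] at h
      have h2 := (Int.ceil_eq_zero_iff.mp h0).1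
      linarith

/-- Coordinatewise rounding towards zero to multiples of `h`. -/
noncomputable def gridPt {n : ℕ} (h : ℝ) (x : Fin n → ℝ) (j : Fin n) : ℝ := h * truncInt (x j / h)

lemma abs_sub_gridPt_le {n : ℕ} {h : ℝ} (hh : 0 < h) (x : Fin n → ℝ) (j : Fin n) :
    |x j - gridPt h x j| ≤ h := by
  have h1 := abs_sub_truncInt_le (x j / h)
  have h2 : x j - gridPt h x j = h * (x j / h - truncInt (x j / h)) := by
    unfold gridPt; field_simp
  rw [h2, abs_mul, abs_of_pos hh]
  nlinarith

lemma abs_gridPt_le {n : ℕ} {h : ℝ} (hh : 0 < h) (x : Fin n → ℝ) (j : Fin n) :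
    |gridPt h x j| ≤ |x j| := by
  have h1 := abs_truncInt_le (x j / h)
  rw [abs_div, abs_of_pos hh, le_div_iff₀ hh] at h1
  rw [gridPt, abs_mul, abs_of_pos hh]
  linarith

lemma truncInt_div_ne_zero_iff {h : ℝ} (hh : 0 < h) (u : ℝ) : truncInt (u / h) ≠ 0 ↔ h ≤ |u| := by
  rw [truncInt_ne_zero_iff, abs_div, abs_of_pos hh, le_div_iff₀ hh, one_mul]

lemma sum_abs_le_sqrt_mul {n : ℕ} {x : Fin n → ℝ} (hx : ∑ j, x j ^ 2 ≤ 1) :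
    ∑ j, |x j| ≤ √(n : ℝ) := by
  apply Real.le_sqrt_of_sq_le
  have := sq_sum_le_card_mul_sum_sq (s := Finset.univ) (f := fun j => |x j|)
  simp only [sq_abs, Finset.card_univ, Fintype.card_fin] at this
  exact this.trans (mul_le_of_le_one_right (by positivity) hx)

lemma sum_abs_truncInt_le {n : ℕ} {h : ℝ} (hh : 0 < h) {x : Fin n → ℝ} (hx : ∑ j, x j ^ 2 ≤ 1) :
    ∑ j, |(truncInt (x j / h) : ℝ)| ≤ √(n : ℝ) / h := by
  calc ∑ j, |(truncInt (x j / h) : ℝ)| ≤ ∑ j, |x j| / h := by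
        refine Finset.sum_le_sum fun j _ => (abs_truncInt_le _).trans_eq ?_
        rw [abs_div, abs_of_pos hh]
    _ = (∑ j, |x j|) / h := by rw [Finset.sum_div]
    _ ≤ _ := by gcongr; exact sum_abs_le_sqrt_mul hx

lemma sum_exp_neg_abs_le (s : Finset ℤ) {R : ℝ} (hR : 1 ≤ R) :
    ∑ k ∈ s, Real.exp (-(|(k : ℝ)| / R)) ≤ 4 * R := by
  set q := Real.exp (-(1 / R)) with hq
  have hq0 : 0 < q := Real.exp_pos _
  have hqR : q ≤ R / (R + 1) := by
    rw [hq, Real.exp_neg, inv_le_comm₀ (Real.exp_pos _) (by positivity), inv_div]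
    have := Real.add_one_le_exp (1 / R)
    calc (R + 1) / R = 1 / R + 1 := by field_simp; ring
      _ ≤ _ := this
  have hq1 : q < 1 := hqR.trans_lt (by rw [div_lt_one (by positivity)]; linarith)
  have hpow : ∀ m : ℕ, Real.exp (-((m : ℝ) / R)) = q ^ m := by
    intro m
    rw [hq, ← Real.exp_nat_mul]; congr 1; ring
  set f : ℤ → ℝ := fun k => Real.exp (-(|(k : ℝ)| / R)) with hf
  have hg := hasSum_geometric_of_lt_one hq0.le hq1
  have ha : HasSum (fun m : ℕ => f m) (1 - q)⁻¹ := by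
    have : (fun m : ℕ => f m) = fun m => q ^ m := funext fun m => by rw [← hpow]; simp [f]
    rw [this]; exact hg
  have hb : HasSum (fun m : ℕ => f (-((m : ℤ) + 1))) (q * (1 - q)⁻¹) := by
    have : (fun m : ℕ => f (-((m : ℤ) + 1))) = fun m => q * q ^ m := funext fun m => ?_
    · rw [this]; exact hg.mul_left q
    have h1 : |((-((m : ℤ) + 1) : ℤ) : ℝ)| = ((m + 1 : ℕ) : ℝ) := by
      push_cast
      rw [abs_of_nonpos (by linarith [(Nat.cast_nonneg m : (0 : ℝ) ≤ m)])]
      ring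
    rw [← pow_succ', ← hpow, hf]
    simp only [h1]
  have hsum := HasSum.of_nat_of_neg_add_one ha hb
  refine (sum_le_hasSum s (fun k _ => (Real.exp_pos _).le) hsum).trans ?_
  have h1 : 1 / (R + 1) ≤ 1 - q := by
    have : R / (R + 1) = 1 - 1 / (R + 1) := by field_simp; ring
    linarith
  have h2 : (1 - q)⁻¹ ≤ R + 1 := by
    rw [inv_le_comm₀ (by linarith) (by linarith), ← one_div]; exact h1
  nlinarith [inv_pos.mpr (sub_pos.mpr hq1)]

/-- The number of integer points in an `ℓ¹` ball of a coordinate subspace. -/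
lemma exists_finset_integerPoints (n : ℕ) (J : Finset (Fin n)) {R : ℝ} (hR : 1 ≤ R) :
    ∃ Z : Finset (Fin n → ℤ), (Z.card : ℝ) ≤ Real.exp n * (4 * R) ^ J.card ∧
      ∀ z : Fin n → ℤ, (∀ j, j ∉ J → z j = 0) → ∑ j, |(z j : ℝ)| ≤ R * n → z ∈ Z := by
  classical
  set N : ℤ := ⌈R * n⌉
  set t : Fin n → Finset ℤ := fun j => if j ∈ J then Finset.Icc (-N) N else {0}
  refine ⟨(Fintype.piFinset t).filter fun z => ∑ j, |(z j : ℝ)| ≤ R * n, ?_, ?_⟩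
  · have h1 : ∀ z ∈ (Fintype.piFinset t).filter fun z => ∑ j, |(z j : ℝ)| ≤ R * n,
        (1 : ℝ) ≤ Real.exp n * ∏ j, Real.exp (-(|(z j : ℝ)| / R)) := by
      intro z hz
      have hz2 := (Finset.mem_filter.mp hz).2
      rw [← Real.exp_sum, ← Real.exp_add, Finset.sum_neg_distrib, ← Finset.sum_div]
      apply Real.one_le_exp
      rw [← sub_eq_add_neg, sub_nonneg, div_le_iff₀ (by linarith)]
      linarith
    calc ((((Fintype.piFinset t).filter fun z => ∑ j, |(z j : ℝ)| ≤ R * n).card : ℕ) : ℝ)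
        = ∑ z ∈ (Fintype.piFinset t).filter fun z => ∑ j, |(z j : ℝ)| ≤ R * n, (1 : ℝ) := by simp
      _ ≤ ∑ z ∈ (Fintype.piFinset t).filter fun z => ∑ j, |(z j : ℝ)| ≤ R * n,
          Real.exp n * ∏ j, Real.exp (-(|(z j : ℝ)| / R)) := Finset.sum_le_sum h1
      _ ≤ ∑ z ∈ Fintype.piFinset t, Real.exp n * ∏ j, Real.exp (-(|(z j : ℝ)| / R)) :=
          Finset.sum_le_sum_of_subset_of_nonneg (Finset.filter_subset _ _)
            fun z _ _ => by positivity
      _ = Real.exp n * ∏ j, ∑ k ∈ t j, Real.exp (-(|(k : ℝ)| / R)) := by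
          rw [← Finset.mul_sum,
            Finset.prod_univ_sum t fun (_ : Fin n) (k : ℤ) => Real.exp (-(|(k : ℝ)| / R))]
      _ ≤ Real.exp n * ∏ j, (if j ∈ J then 4 * R else 1) := by
          gcongr with j _
          by_cases hj : j ∈ J
          · simp only [hj, if_true]; exact sum_exp_neg_abs_le _ hR
          · simp [t, hj]
      _ = _ := by rw [Finset.prod_ite_mem]; simp
  · intro z hz hzs
    refine Finset.mem_filter.mpr ⟨Fintype.mem_piFinset.mpr fun j => ?_, hzs⟩
    by_cases hj : j ∈ J
    · simp only [t, hj, if_true, Finset.mem_Icc]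
      rw [← abs_le]
      have h1 : |(z j : ℝ)| ≤ R * n :=
        (Finset.single_le_sum (f := fun j => |(z j : ℝ)|) (fun _ _ => abs_nonneg _)
          (Finset.mem_univ j)).trans hzs
      have h2 : ((|z j| : ℤ) : ℝ) ≤ N := by
        push_cast; exact h1.trans (Int.le_ceil _)
      exact_mod_cast h2
    · simp [t, hj, hz j hj]

/-! ### The operator norm of the centred matrix -/

/-- The integral is `(1 - v/2)^(-1/2) ≤ √2`; the cruder constant `e` multiplies to `exp n` over `n`
rows. -/
lemma lintegral_exp_sq_gaussianReal_le (m : ℝ) (v : NNReal) (hv1 : v ≤ 1) :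
    ∫⁻ x, ENNReal.ofReal (Real.exp ((x - m) ^ 2 / 4)) ∂gaussianReal m v ≤
      ENNReal.ofReal (Real.exp 1) := by
  by_cases hv : v = 0
  · subst hv
    rw [gaussianReal_zero_var, lintegral_dirac]
    apply ENNReal.ofReal_le_ofReal
    simp
  have hv0 : (0 : ℝ) < v := by positivity
  have hv1' : (v : ℝ) ≤ 1 := by exact_mod_cast hv1
  rw [gaussianReal_of_var_ne_zero _ hv, lintegral_withDensity_eq_lintegral_mul _
    (measurable_gaussianPDF m v) (by fun_prop)]
  set β : ℝ := 1 / (2 * v) - 1 / 4 with hβ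
  have hβ1 : 1 / (4 * v) ≤ β := by
    have h1 : 1 / (2 * (v : ℝ)) = 1 / (4 * v) + 1 / (4 * v) := by field_simp; norm_num
    have h2 : (1 : ℝ) / 4 ≤ 1 / (4 * v) := by
      apply one_div_le_one_div_of_le <;> linarith
    rw [hβ]; linarith
  have hβ0 : 0 < β := lt_of_lt_of_le (by positivity) hβ1
  have hb : ∀ x, (gaussianPDF m v * fun x => ENNReal.ofReal (Real.exp ((x - m) ^ 2 / 4))) x =
      ENNReal.ofReal ((√(2 * Real.pi * v))⁻¹ * Real.exp (-β * (x - m) ^ 2)) := by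
    intro x
    simp only [Pi.mul_apply, gaussianPDF]
    rw [← ENNReal.ofReal_mul (gaussianPDFReal_nonneg _ _ _), gaussianPDFReal_def, mul_assoc,
      ← Real.exp_add]
    congr 3
    rw [hβ]; field_simp; ring
  rw [lintegral_congr hb]
  have hint : Integrable fun x : ℝ => Real.exp (-β * (x - m) ^ 2) :=
    (integrable_exp_neg_mul_sq hβ0).comp_sub_right m
  rw [← ofReal_integral_eq_lintegral_ofReal (hint.const_mul _)
    (Filter.Eventually.of_forall fun x => by positivity), integral_const_mul,
    integral_sub_right_eq_self (fun x => Real.exp (-β * x ^ 2)) m, integral_gaussian]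
  apply ENNReal.ofReal_le_ofReal
  have h1 : √(Real.pi / β) ≤ √(2 * (2 * Real.pi * v)) := by
    apply Real.sqrt_le_sqrt
    rw [div_le_iff₀ hβ0]
    calc Real.pi = 2 * (2 * Real.pi * v) * (1 / (4 * v)) := by field_simp; norm_num
      _ ≤ _ := by gcongr
  rw [Real.sqrt_mul (by norm_num)] at h1
  have h2 : 0 < √(2 * Real.pi * v) := by have := Real.pi_pos; positivity
  rw [inv_mul_le_iff₀ h2]
  have h3 : √2 ≤ Real.exp 1 := by
    have : √2 ≤ 2 := by rw [Real.sqrt_le_iff]; norm_num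
    linarith [Real.add_one_le_exp 1]
  calc _ ≤ √2 * √(2 * Real.pi * v) := h1
    _ ≤ _ := by rw [mul_comm]; gcongr

lemma gaussMat_largeDeviation {n : ℕ} (b a : Fin n → Fin n → ℝ) (ha : ∀ i j, |a i j| ≤ 1)
    (y : Fin n → ℝ) (hy : ∑ j, y j ^ 2 ≤ 1) (N : ℝ) :
    gaussMat b a {M | N ≤ ∑ i, (∑ j, (M i j - b i j) * y j) ^ 2} ≤
      ENNReal.ofReal (Real.exp (n - N / 4)) := by
  set f : Fin n → ℝ → ENNReal := fun i x =>
    ENNReal.ofReal (Real.exp ((x - ∑ j, b i j * y j) ^ 2 / 4)) with hf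
  set F : (Fin n → Fin n → ℝ) → ENNReal := fun M => ∏ i, f i (∑ j, M i j * y j) with hF
  have hfm : ∀ i, Measurable (f i) := fun i => by fun_prop
  have hFm : Measurable F := by fun_prop
  have hsub : {M : Fin n → Fin n → ℝ | N ≤ ∑ i, (∑ j, (M i j - b i j) * y j) ^ 2} ⊆
      {M | ENNReal.ofReal (Real.exp (N / 4)) ≤ F M} := by
    intro M hM
    simp only [Set.mem_ofPred_eq, hF, hf] at hM ⊢
    rw [← ENNReal.ofReal_prod_of_nonneg (fun i _ => (Real.exp_pos _).le), ← Real.exp_sum]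
    apply ENNReal.ofReal_le_ofReal
    apply Real.exp_le_exp.mpr
    rw [← Finset.sum_div]
    simp only [sub_mul, Finset.sum_sub_distrib] at hM
    linarith
  refine (measure_mono hsub).trans ?_
  refine (meas_ge_le_lintegral_div hFm.aemeasurable (by simp [Real.exp_pos])
    ENNReal.ofReal_ne_top).trans ?_
  rw [hF, lintegral_prod_rows b a y Finset.univ hfm]
  have h1 : ∏ i, ∫⁻ M : Fin n → Fin n → ℝ, f i (∑ j, M i j * y j) ∂gaussMat b a ≤
      ENNReal.ofReal (Real.exp 1 ^ n) := by
    rw [ENNReal.ofReal_pow (by positivity)]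
    refine (Finset.prod_le_prod' (g := fun _ => ENNReal.ofReal (Real.exp 1)) fun i _ => ?_).trans
      (by simp)
    rw [lintegral_row_eq b a y i (hfm i)]
    refine lintegral_exp_sq_gaussianReal_le _ _ ?_
    rw [← NNReal.coe_le_coe]
    push_cast
    simp only [coe_sqNN]
    refine (Finset.sum_le_sum fun j _ => ?_).trans hy
    have : a i j ^ 2 ≤ 1 := (sq_le_one_iff_abs_le_one _).mpr (ha i j)
    exact mul_le_of_le_one_left (sq_nonneg _) this
  refine (ENNReal.div_le_div_right h1 _).trans ?_
  rw [← ENNReal.ofReal_div_of_pos (Real.exp_pos _)]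
  apply ENNReal.ofReal_le_ofReal
  rw [Real.exp_sub, ← Real.exp_nat_mul, mul_one]

lemma sum_sq_mulVec_eq_norm_sq {n : ℕ} (G : Matrix (Fin n) (Fin n) ℝ)
    (x : EuclideanSpace ℝ (Fin n)) :
    ‖Matrix.toEuclideanCLM (n := Fin n) (𝕜 := ℝ) G x‖ ^ 2 = ∑ i, (∑ j, G i j * x j) ^ 2 := by
  rw [EuclideanSpace.real_norm_sq_eq]
  rfl

lemma sum_sq_mulVec_le {n : ℕ} (G : Matrix (Fin n) (Fin n) ℝ) {D : ℝ}
    (h : euclideanOpNorm G ≤ D) (x : Fin n → ℝ) :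
    ∑ i, (∑ j, G i j * x j) ^ 2 ≤ D ^ 2 * ∑ j, x j ^ 2 := by
  have h1 := (Matrix.toEuclideanCLM (n := Fin n) (𝕜 := ℝ) G).le_of_opNorm_le h (WithLp.toLp 2 x)
  have h2 := pow_le_pow_left₀ (norm_nonneg _) h1 2
  rw [sum_sq_mulVec_eq_norm_sq, mul_pow, EuclideanSpace.real_norm_sq_eq] at h2
  exact h2

lemma euclideanOpNorm_transpose {n : ℕ} (G : Matrix (Fin n) (Fin n) ℝ) :
    euclideanOpNorm G.transpose = euclideanOpNorm G := by
  unfold euclideanOpNorm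
  have : G.transpose = star G := by
    rw [Matrix.star_eq_conjTranspose, Matrix.conjTranspose_eq_transpose_of_trivial]
  rw [this, map_star, ContinuousLinearMap.star_eq_adjoint, LinearIsometryEquiv.norm_map]

lemma sum_sq_sub_gridPt_le {n : ℕ} {h : ℝ} (hh : 0 < h) (x : Fin n → ℝ) :
    ∑ j, (x j - gridPt h x j) ^ 2 ≤ n * h ^ 2 := by
  calc ∑ j, (x j - gridPt h x j) ^ 2 ≤ ∑ _j : Fin n, h ^ 2 :=
        Finset.sum_le_sum fun j _ => sq_le_sq.mpr (by
          rw [abs_of_pos hh]; exact abs_sub_gridPt_le hh x j)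
    _ = _ := by simp

lemma sum_sq_gridPt_le {n : ℕ} {h : ℝ} (hh : 0 < h) (x : Fin n → ℝ) :
    ∑ j, gridPt h x j ^ 2 ≤ ∑ j, x j ^ 2 :=
  Finset.sum_le_sum fun j _ => sq_le_sq.mpr (abs_gridPt_le hh x j)

/-- Rounding at this mesh moves a unit vector by at most `1/2`, so `‖T‖ ≤ D + ‖T‖/2`. -/
lemma euclideanOpNorm_le_of_gridPt {n : ℕ} (hn : 0 < n) (G : Matrix (Fin n) (Fin n) ℝ) {D : ℝ}
    (hD : 0 ≤ D)
    (hG : ∀ x : Fin n → ℝ, ∑ j, x j ^ 2 ≤ 1 →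
      ∑ i, (∑ j, G i j * gridPt (1 / (2 * √(n : ℝ))) x j) ^ 2 ≤ D ^ 2) :
    euclideanOpNorm G ≤ 2 * D := by
  unfold euclideanOpNorm
  set T := Matrix.toEuclideanCLM (n := Fin n) (𝕜 := ℝ) G with hT
  have hn' : (0 : ℝ) < n := by exact_mod_cast hn
  set h : ℝ := 1 / (2 * √(n : ℝ)) with hh
  have hh0 : 0 < h := by positivity
  have key : ‖T‖ ≤ D + ‖T‖ * (1 / 2) := by
    refine ContinuousLinearMap.opNorm_le_of_unit_norm (by positivity) fun x hx => ?_
    set y : EuclideanSpace ℝ (Fin n) := WithLp.toLp 2 (gridPt h x) with hy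
    have hx2 : ∑ j, x j ^ 2 = 1 := by
      rw [← EuclideanSpace.real_norm_sq_eq, hx, one_pow]
    have h1 : ‖T y‖ ≤ D := by
      rw [← sq_le_sq₀ (norm_nonneg _) hD, sum_sq_mulVec_eq_norm_sq]
      exact hG x hx2.le
    have h2 : ‖x - y‖ ≤ 1 / 2 := by
      rw [← sq_le_sq₀ (norm_nonneg _) (by norm_num), EuclideanSpace.real_norm_sq_eq]
      refine (sum_sq_sub_gridPt_le hh0 x).trans_eq ?_
      rw [hh, div_pow, mul_pow, Real.sq_sqrt hn'.le]
      field_simp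
    calc ‖T x‖ = ‖T y + T (x - y)‖ := by rw [← map_add]; simp
      _ ≤ ‖T y‖ + ‖T (x - y)‖ := norm_add_le _ _
      _ ≤ D + ‖T‖ * (1 / 2) := add_le_add h1 (T.le_opNorm_of_le h2)
  linarith

lemma eight_le_exp_three : (8 : ℝ) ≤ Real.exp 3 := by
  have h1 : Real.exp 3 = Real.exp 1 ^ 3 := by rw [← Real.exp_nat_mul]; norm_num
  have h2 : (2 : ℝ) ≤ Real.exp 1 := by linarith [Real.add_one_le_exp 1]
  rw [h1]
  calc (8 : ℝ) = 2 ^ 3 := by norm_num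
    _ ≤ _ := by gcongr

/-- The operator norm of a centred Gaussian matrix is `O(√n)`. -/
lemma gaussMat_opNorm {n : ℕ} (hn : 0 < n) (b a : Fin n → Fin n → ℝ)
    (ha : ∀ i j, |a i j| ≤ 1) :
    (gaussMat b a).real {M | ¬ euclideanOpNorm (Matrix.of M - Matrix.of b) ≤ 12 * √(n : ℝ)} ≤
      Real.exp (-2 * n) := by
  have hn' : (0 : ℝ) < n := by exact_mod_cast hn
  set h : ℝ := 1 / (2 * √(n : ℝ)) with hh
  have hh0 : 0 < h := by positivity
  -- At mesh `1/(2√n)` the bound `√n / h` on the `ℓ¹` norm is `2n`, so `R = 2`.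
  obtain ⟨Z, hZc, hZ⟩ := exists_finset_integerPoints n Finset.univ (R := 2) (by norm_num)
  set Z' := Z.filter fun z => ∑ j, (h * z j) ^ 2 ≤ 1
  have hsub : {M | ¬ euclideanOpNorm (Matrix.of M - Matrix.of b) ≤ 12 * √(n : ℝ)} ⊆
      ⋃ z ∈ Z', {M | 36 * (n : ℝ) ≤ ∑ i, (∑ j, (M i j - b i j) * (h * z j)) ^ 2} := by
    intro M hM
    by_contra hcon
    refine hM ?_
    have := euclideanOpNorm_le_of_gridPt hn (Matrix.of M - Matrix.of b) (D := 6 * √(n : ℝ))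
      (by positivity) fun x hx => ?_
    · linarith
    · by_contra hlt
      push Not at hlt
      refine hcon (Set.mem_biUnion (x := fun j => truncInt (x j / h)) ?_ ?_)
      · refine Finset.mem_coe.mpr (Finset.mem_filter.mpr ⟨hZ _ (by simp) ?_, ?_⟩)
        · refine (sum_abs_truncInt_le hh0 hx).trans_eq ?_
          rw [hh, div_div_eq_mul_div, div_one]
          nlinarith [Real.mul_self_sqrt hn'.le]
        · exact (sum_sq_gridPt_le hh0 x).trans hx
      · rw [mul_pow, Real.sq_sqrt hn'.le, show (6 : ℝ) ^ 2 = 36 by norm_num] at hlt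
        exact hlt.le
  refine (measureReal_mono hsub (measure_ne_top _ _)).trans ((measureReal_biUnion_finset_le _ _).trans ?_)
  -- The level `36n` gives `exp (n - 9n)`, enough to absorb the at most `e^n 8^n ≤ e^(4n)` lattice
  -- points.
  have hone : ∀ z ∈ Z', (gaussMat b a).real
      {M | 36 * (n : ℝ) ≤ ∑ i, (∑ j, (M i j - b i j) * (h * z j)) ^ 2} ≤ Real.exp (-8 * n) := by
    intro z hz
    refine ENNReal.toReal_le_of_le_ofReal (Real.exp_pos _).le
      ((gaussMat_largeDeviation b a ha _ (Finset.mem_filter.mp hz).2 _).trans_eq ?_)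
    congr 2; ring
  refine (Finset.sum_le_sum hone).trans ?_
  rw [Finset.sum_const, nsmul_eq_mul]
  have h8 : ((4 : ℝ) * 2) ^ n ≤ Real.exp (3 * n) := by
    rw [mul_comm (3 : ℝ), Real.exp_nat_mul]
    refine pow_le_pow_left₀ (by norm_num) ?_ n
    norm_num
    exact eight_le_exp_three
  calc (Z'.card : ℝ) * Real.exp (-8 * n) ≤ Z.card * Real.exp (-8 * n) := by
        gcongr; exact Finset.filter_subset _ _
    _ ≤ (Real.exp n * Real.exp (3 * n)) * Real.exp (-8 * n) := by
        gcongr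
        refine hZc.trans ?_
        rw [Finset.card_univ, Fintype.card_fin]
        gcongr
    _ = Real.exp (-4 * n) := by rw [← Real.exp_add, ← Real.exp_add]; congr 1; ring
    _ ≤ _ := Real.exp_le_exp.mpr (by linarith)

/-! ### The union bound over lattice vectors -/

/-- The event that the image of some lattice vector is atypically small on a set of rows which is
larger, by a proportion `η`, than the support of the vector. -/
def latticeBad {n : ℕ} (a : Fin n → Fin n → ℝ) (s ρ η L : ℝ) : Set (Fin n → Fin n → ℝ) :=
  {M | ∃ (z : Fin n → ℤ) (S : Finset (Fin n)), ∑ j, |(z j : ℝ)| ≤ 1 / ρ * n ∧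
    ((Finset.univ.filter fun j => z j ≠ 0).card : ℝ) + η * n ≤ S.card ∧
    (∀ i ∈ S, s ^ 2 ≤ rowVar a (fun j => ρ / √(n : ℝ) * z j) i) ∧
    ∑ i ∈ S, (∑ j, M i j * (ρ / √(n : ℝ) * z j)) ^ 2 ≤ (L * ρ) ^ 2 * n}

lemma gaussMat_latticeBad {n : ℕ} (b a : Fin n → Fin n → ℝ) {s ρ η L : ℝ}
    (hs : 0 < s) (hsL : s ≤ L) (hρ : 0 < ρ) (hρ1 : ρ ≤ 1) (hL : L * ρ ≤ s)
    (hbd : 16 * Real.exp 4 * (L / s) * (L * ρ / s) ^ η ≤ 1) :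
    (gaussMat b a).real (latticeBad a s ρ η L) ≤ Real.exp (-2 * n) := by
  classical
  have hL0 : 0 < L := hs.trans_le hsL
  set q : ℝ := L * ρ / s with hq
  have hq0 : 0 < q := by positivity
  have hq1 : q ≤ 1 := by rw [hq, div_le_one hs]; exact hL
  choose Z hZc hZ using fun J : Finset (Fin n) =>
    exists_finset_integerPoints n J (R := 1 / ρ) (by rw [le_div_iff₀ hρ]; linarith)
  set 𝒮 : Finset (Fin n) → (Fin n → ℤ) → Finset (Finset (Fin n)) := fun J z =>
    Finset.univ.filter fun S => (J.card : ℝ) + η * n ≤ S.card ∧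
      ∀ i ∈ S, s ^ 2 ≤ rowVar a (fun j => ρ / √(n : ℝ) * z j) i with h𝒮
  have hsub : latticeBad a s ρ η L ⊆ ⋃ J ∈ (Finset.univ : Finset (Finset (Fin n))), ⋃ z ∈ Z J,
      ⋃ S ∈ 𝒮 J z, {M | ∑ i ∈ S, (∑ j, M i j * (ρ / √(n : ℝ) * z j)) ^ 2 ≤ (L * ρ) ^ 2 * n} := by
    rintro M ⟨z, S, h1, h2, h3, h4⟩
    refine Set.mem_biUnion (x := Finset.univ.filter fun j => z j ≠ 0) (by simp) ?_
    refine Set.mem_biUnion (x := z) (hZ _ z (by simp) h1) ?_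
    exact Set.mem_biUnion (x := S) (by simp [𝒮, h2]; exact h3) h4
  have hone : ∀ J z, ∀ S ∈ 𝒮 J z, (gaussMat b a).real
      {M | ∑ i ∈ S, (∑ j, M i j * (ρ / √(n : ℝ) * z j)) ^ 2 ≤ (L * ρ) ^ 2 * n} ≤
      Real.exp n * (q ^ J.card * q ^ (η * n)) := by
    intro J z S hS
    obtain ⟨hS1, hS2⟩ := (Finset.mem_filter.mp hS).2
    refine (ENNReal.toReal_le_of_le_ofReal (by positivity)
      (gaussMat_smallBall b a _ S hs hS2 (by positivity))).trans ?_
    gcongr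
    rw [← Real.rpow_natCast, ← Real.rpow_natCast, ← Real.rpow_add hq0]
    exact Real.rpow_le_rpow_of_exponent_ge hq0 hq1 hS1
  have hS : ∀ J z, (gaussMat b a).real (⋃ S ∈ 𝒮 J z,
      {M | ∑ i ∈ S, (∑ j, M i j * (ρ / √(n : ℝ) * z j)) ^ 2 ≤ (L * ρ) ^ 2 * n}) ≤
      2 ^ n * (Real.exp n * (q ^ J.card * q ^ (η * n))) := by
    intro J z
    refine (measureReal_biUnion_finset_le _ _).trans ((Finset.sum_le_sum (hone J z)).trans ?_)
    rw [Finset.sum_const, nsmul_eq_mul]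
    gcongr
    have : ((𝒮 J z).card : ℝ) ≤ ((Finset.univ : Finset (Finset (Fin n))).card : ℝ) := by
      exact_mod_cast Finset.card_le_card (Finset.filter_subset _ _)
    simpa using this
  have h4L : 1 ≤ 4 * (L / s) := by
    have : 1 ≤ L / s := by rw [le_div_iff₀ hs]; linarith
    linarith
  have hJ : ∀ J, (gaussMat b a).real (⋃ z ∈ Z J, ⋃ S ∈ 𝒮 J z,
      {M | ∑ i ∈ S, (∑ j, M i j * (ρ / √(n : ℝ) * z j)) ^ 2 ≤ (L * ρ) ^ 2 * n}) ≤
      Real.exp n * (2 ^ n * Real.exp n * q ^ (η * n)) * (4 * (L / s)) ^ n := by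
    intro J
    refine (measureReal_biUnion_finset_le _ _).trans
      ((Finset.sum_le_sum fun z _ => hS J z).trans ?_)
    rw [Finset.sum_const, nsmul_eq_mul]
    calc ((Z J).card : ℝ) * (2 ^ n * (Real.exp n * (q ^ J.card * q ^ (η * n))))
        ≤ (Real.exp n * (4 * (1 / ρ)) ^ J.card) *
          (2 ^ n * (Real.exp n * (q ^ J.card * q ^ (η * n)))) := by
          gcongr; exact hZc J
      -- The cancellation: `(4/ρ)^|J|` points against `q^|J|` leave `(4L/s)^|J|`, free of `ρ`; only
      -- the surplus `q^(ηn)` still depends on `ρ`.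
      _ = Real.exp n * (2 ^ n * Real.exp n * q ^ (η * n)) * (4 * (1 / ρ) * q) ^ J.card := by
          rw [mul_pow _ q]; ring
      _ = Real.exp n * (2 ^ n * Real.exp n * q ^ (η * n)) * (4 * (L / s)) ^ J.card := by
          congr 2; rw [hq]; field_simp
      _ ≤ _ := by
          gcongr
          simpa using Finset.card_le_univ J
  refine (measureReal_mono hsub (measure_ne_top _ _)).trans ((measureReal_biUnion_finset_le _ _).trans
    ((Finset.sum_le_sum fun J _ => hJ J).trans ?_))
  rw [Finset.sum_const, nsmul_eq_mul]
  have hcard : (((Finset.univ : Finset (Finset (Fin n))).card : ℕ) : ℝ) = 2 ^ n := by simp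
  have e1 : Real.exp (n : ℝ) = Real.exp 1 ^ n := by rw [← Real.exp_nat_mul, mul_one]
  have e2 : q ^ (η * n) = (q ^ η) ^ n := by rw [Real.rpow_mul hq0.le, Real.rpow_natCast]
  have e3 : Real.exp (-2 * n) = Real.exp (-2) ^ n := by rw [← Real.exp_nat_mul]; congr 1; ring
  have e4 : Real.exp 4 = Real.exp 1 * Real.exp 1 * Real.exp 2 := by
    rw [← Real.exp_add, ← Real.exp_add]; norm_num
  rw [hcard, e1, e2, e3]
  calc (2 : ℝ) ^ n * (Real.exp 1 ^ n * (2 ^ n * Real.exp 1 ^ n * (q ^ η) ^ n) * (4 * (L / s)) ^ n)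
      = (16 * (Real.exp 1 * Real.exp 1) * (L / s) * q ^ η) ^ n := by
        rw [← mul_pow, ← mul_pow, ← mul_pow, ← mul_pow, ← mul_pow]; ring
    _ ≤ Real.exp (-2) ^ n := by
        refine pow_le_pow_left₀ (by positivity) ?_ n
        rw [Real.exp_neg, ← one_div, le_div_iff₀ (Real.exp_pos _)]
        rw [e4] at hbd
        linarith

/-- With `s = L^(-q)`, the exponent of `ρ` is chosen so that `(Lρ/s)^η = L^(-(2+q))`. Against `L/s =
L^(1+q)` this leaves a factor `1/L`, which absorbs `16 e^4`. -/
lemma gaussMat_latticeBad_rpow {n : ℕ} (b a : Fin n → Fin n → ℝ) {q η L : ℝ}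
    (hq : 0 ≤ q) (hη : 0 < η) (hL : 16 * Real.exp 4 ≤ L) :
    (gaussMat b a).real (latticeBad a (L ^ (-q)) (L ^ (-(1 + q + (2 + q) / η))) η L) ≤
      Real.exp (-2 * n) := by
  have hL1 : 1 ≤ L := by
    have := Real.one_le_exp (show (0 : ℝ) ≤ 4 by norm_num); linarith
  have hL0 : 0 < L := by linarith
  have hdiv : 0 ≤ (2 + q) / η := by positivity
  have h1 : L * L ^ (-(1 + q + (2 + q) / η)) = L ^ (-(q + (2 + q) / η)) := by
    nth_rewrite 1 [← Real.rpow_one L]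
    rw [← Real.rpow_add hL0]; congr 1; ring
  refine gaussMat_latticeBad b a (by positivity) ?_ (by positivity) ?_ ?_ ?_
  · exact (Real.rpow_le_one_of_one_le_of_nonpos hL1 (by linarith)).trans hL1
  · exact Real.rpow_le_one_of_one_le_of_nonpos hL1 (by linarith)
  · rw [h1]; exact Real.rpow_le_rpow_of_exponent_le hL1 (by linarith)
  · rw [h1, ← Real.rpow_sub hL0, ← Real.rpow_mul hL0.le]
    have h2 : L / L ^ (-q) = L ^ (1 + q) := by
      rw [Real.rpow_add hL0, Real.rpow_one, Real.rpow_neg hL0.le, div_inv_eq_mul]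
    have h3 : (-(q + (2 + q) / η) - -q) * η = -(2 + q) := by field_simp; ring
    rw [h2, h3]
    calc 16 * Real.exp 4 * L ^ (1 + q) * L ^ (-(2 + q)) ≤ L * L ^ (1 + q) * L ^ (-(2 + q)) := by
          gcongr
      _ = L ^ ((1 : ℝ) + (1 + q) + (-(2 + q))) := by
          rw [Real.rpow_add hL0 (1 + (1 + q)), Real.rpow_add hL0 1 (1 + q), Real.rpow_one]
      _ = 1 := by
          rw [show (1 : ℝ) + (1 + q) + (-(2 + q)) = 0 by ring, Real.rpow_zero]

/-! ### Spread of almost annihilated vectors -/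

/-- The number of coordinates of `x` of absolute value at least `ρ / √n`. -/
noncomputable def bigCoords {n : ℕ} (ρ : ℝ) (x : Fin n → ℝ) : Finset (Fin n) :=
  Finset.univ.filter fun j => ρ / √(n : ℝ) ≤ |x j|

/-- `M` is bounded by `(L / 2) √n` in the Euclidean operator norm. -/
def NormBounded {n : ℕ} (L : ℝ) (M : Fin n → Fin n → ℝ) : Prop :=
  ∀ x : Fin n → ℝ, ∑ i, (∑ j, M i j * x j) ^ 2 ≤ (L / 2) ^ 2 * n * ∑ j, x j ^ 2

/-- Transfers the lattice estimate to arbitrary unit vectors. Rounding changes `M x` by at most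
`(L/2) ρ √n`, so if `M x` is this small on `S`, the rounded image is at most `L ρ √n` there; were
all variances on `S` large, the rounded vector would witness the bad event. -/
lemma exists_rowVar_lt_of_notMem_latticeBad {n : ℕ} (hn : 0 < n) {a M : Fin n → Fin n → ℝ}
    {s ρ η L : ℝ} (hρ : 0 < ρ) (hM : NormBounded L M) (hbad : M ∉ latticeBad a s ρ η L)
    {x : Fin n → ℝ} (hx : ∑ j, x j ^ 2 = 1) {S : Finset (Fin n)}
    (hS : ((bigCoords ρ x).card : ℝ) + η * n ≤ S.card)
    (hMx : ∑ i ∈ S, (∑ j, M i j * x j) ^ 2 ≤ (L / 2 * ρ) ^ 2 * n) :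
    ∃ i ∈ S, rowVar a (gridPt (ρ / √(n : ℝ)) x) i < s ^ 2 := by
  have hn' : (0 : ℝ) < n := by exact_mod_cast hn
  set h : ℝ := ρ / √(n : ℝ) with hh
  have hh0 : 0 < h := by positivity
  by_contra! hcon
  refine hbad ⟨fun j => truncInt (x j / h), S, ?_, ?_, hcon, ?_⟩
  · refine (sum_abs_truncInt_le hh0 hx.le).trans_eq ?_
    rw [hh]
    field_simp
    exact Real.sq_sqrt hn'.le
  · simp only [truncInt_div_ne_zero_iff hh0]
    exact hS
  · have h1 : ∑ i, (∑ j, M i j * (x j - gridPt h x j)) ^ 2 ≤ (L / 2) ^ 2 * n * ρ ^ 2 := by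
      refine (hM _).trans ?_
      refine mul_le_mul_of_nonneg_left ((sum_sq_sub_gridPt_le hh0 x).trans_eq ?_) (by positivity)
      rw [hh, div_pow, Real.sq_sqrt hn'.le]
      field_simp
    have h2 : ∑ i ∈ S, (∑ j, M i j * (x j - gridPt h x j)) ^ 2 ≤ (L / 2) ^ 2 * n * ρ ^ 2 :=
      (Finset.sum_le_sum_of_subset_of_nonneg (Finset.subset_univ S)
        fun _ _ _ => sq_nonneg _).trans h1
    calc ∑ i ∈ S, (∑ j, M i j * gridPt h x j) ^ 2
        ≤ ∑ i ∈ S, (2 * (∑ j, M i j * x j) ^ 2 +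
            2 * (∑ j, M i j * (x j - gridPt h x j)) ^ 2) := by
          refine Finset.sum_le_sum fun i _ => ?_
          have h3 : ∑ j, M i j * gridPt h x j =
              ∑ j, M i j * x j - ∑ j, M i j * (x j - gridPt h x j) := by
            rw [← Finset.sum_sub_distrib]
            exact Finset.sum_congr rfl fun j _ => by ring
          rw [h3]
          nlinarith [sq_nonneg (∑ j, M i j * x j + ∑ j, M i j * (x j - gridPt h x j))]
      _ = 2 * ∑ i ∈ S, (∑ j, M i j * x j) ^ 2 +
            2 * ∑ i ∈ S, (∑ j, M i j * (x j - gridPt h x j)) ^ 2 := by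
          rw [Finset.sum_add_distrib, Finset.mul_sum, Finset.mul_sum]
      _ ≤ 2 * ((L / 2 * ρ) ^ 2 * n) + 2 * ((L / 2) ^ 2 * n * ρ ^ 2) := by gcongr
      _ = (L * ρ) ^ 2 * n := by ring

lemma rowVar_le_one {n : ℕ} {a : Fin n → Fin n → ℝ} (ha : ∀ i j, |a i j| ≤ 1) {y : Fin n → ℝ}
    (hy : ∑ j, y j ^ 2 ≤ 1) (i : Fin n) : rowVar a y i ≤ 1 :=
  (Finset.sum_le_sum fun j _ => mul_le_of_le_one_left (sq_nonneg (y j))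
    ((sq_le_one_iff_abs_le_one _).mpr (ha i j))).trans hy

/-- If all columns of the profile have many nonzero entries, then many row forms have large
variance. -/
lemma card_rowVar_ge {n : ℕ} {a : Fin n → Fin n → ℝ} {r δ s : ℝ} (hr : 0 ≤ r)
    (ha : ∀ i j, |a i j| ≤ 1) (har : ∀ i j, a i j ≠ 0 → r ≤ |a i j|)
    (hdeg : ∀ j, δ * n ≤ ((Finset.univ.filter fun i => a i j ≠ 0).card : ℝ))
    {y : Fin n → ℝ} (hy1 : ∑ j, y j ^ 2 ≤ 1) (hy : 1 / 4 ≤ ∑ j, y j ^ 2) (hδ : 0 ≤ δ)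
    (hs : s ^ 2 ≤ r ^ 2 * δ / 8) :
    r ^ 2 * δ / 8 * n ≤ ((Finset.univ.filter fun i => s ^ 2 ≤ rowVar a y i).card : ℝ) := by
  have hcol : ∀ j, r ^ 2 * (δ * n) ≤ ∑ i, a i j ^ 2 := by
    intro j
    calc r ^ 2 * (δ * n) ≤ r ^ 2 * ((Finset.univ.filter fun i => a i j ≠ 0).card : ℝ) := by
          gcongr; exact hdeg j
      _ = ∑ i ∈ Finset.univ.filter fun i => a i j ≠ 0, r ^ 2 := by simp [mul_comm]
      _ ≤ ∑ i ∈ Finset.univ.filter fun i => a i j ≠ 0, a i j ^ 2 := by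
          refine Finset.sum_le_sum fun i hi => ?_
          rw [← sq_abs (a i j)]
          exact pow_le_pow_left₀ hr (har i j (Finset.mem_filter.mp hi).2) 2
      _ ≤ _ := Finset.sum_le_sum_of_subset_of_nonneg (Finset.filter_subset _ _)
          fun _ _ _ => sq_nonneg _
  have h1 : r ^ 2 * δ / 4 * n ≤ ∑ i, rowVar a y i := by
    unfold rowVar
    rw [Finset.sum_comm]
    calc r ^ 2 * δ / 4 * n = r ^ 2 * (δ * n) * (1 / 4) := by ring
      _ ≤ r ^ 2 * (δ * n) * ∑ j, y j ^ 2 := by gcongr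
      _ = ∑ j, r ^ 2 * (δ * n) * y j ^ 2 := by rw [Finset.mul_sum]
      _ ≤ ∑ j, (∑ i, a i j ^ 2) * y j ^ 2 :=
          Finset.sum_le_sum fun j _ => mul_le_mul_of_nonneg_right (hcol j) (sq_nonneg _)
      _ = _ := by simp_rw [Finset.sum_mul]
  -- A row variance never exceeds 1, so a large total forces many rows above `s²`; the others
  -- contribute at most half of the lower bound `h1`.
  have h2 : ∑ i, rowVar a y i ≤
      ((Finset.univ.filter fun i => s ^ 2 ≤ rowVar a y i).card : ℝ) + s ^ 2 * n := by
    calc ∑ i, rowVar a y i ≤ ∑ i, ((if s ^ 2 ≤ rowVar a y i then 1 else 0) + s ^ 2) := by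
          refine Finset.sum_le_sum fun i _ => ?_
          split_ifs with hi
          · linarith [rowVar_le_one ha hy1 i, sq_nonneg s]
          · linarith
      _ = _ := by rw [Finset.sum_add_distrib]; simp [mul_comm]
  have h3 : s ^ 2 * n ≤ r ^ 2 * δ / 8 * n := by gcongr
  nlinarith

lemma sub_one_le_card_erase {n : ℕ} (T : Finset (Fin n)) (k : Fin n) :
    (T.card : ℝ) - 1 ≤ ((T.erase k).card : ℝ) := by
  have := Finset.pred_card_le_card_erase (s := T) (a := k)
  have h2 : T.card ≤ (T.erase k).card + 1 := by omega
  have : (T.card : ℝ) ≤ ((T.erase k).card : ℝ) + 1 := by exact_mod_cast h2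
  linarith

/-- Vectors almost annihilated by `M` are not very sparse. -/
lemma le_card_bigCoords_of_degree {n : ℕ} (hn : 0 < n) {a M : Fin n → Fin n → ℝ}
    {r δ s ρ η α L : ℝ} (hr : 0 ≤ r) (hδ : 0 ≤ δ)
    (ha : ∀ i j, |a i j| ≤ 1) (har : ∀ i j, a i j ≠ 0 → r ≤ |a i j|)
    (hdeg : ∀ j, δ * n ≤ ((Finset.univ.filter fun i => a i j ≠ 0).card : ℝ))
    (hs : s ^ 2 ≤ r ^ 2 * δ / 8) (hα : α = r ^ 2 * δ / 32) (hηα : η ≤ α) (hηn : 1 ≤ η * n)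
    (hρ : 0 < ρ) (hρ2 : ρ ≤ 1 / 2) (hM : NormBounded L M) (hbad : M ∉ latticeBad a s ρ η L)
    {x : Fin n → ℝ} (hx : ∑ j, x j ^ 2 = 1) (k : Fin n)
    (hMx : ∑ i ∈ Finset.univ.erase k, (∑ j, M i j * x j) ^ 2 ≤ (L / 2 * ρ) ^ 2 * n) :
    α * n ≤ ((bigCoords ρ x).card : ℝ) := by
  have hn' : (0 : ℝ) < n := by exact_mod_cast hn
  by_contra! hcon
  set h : ℝ := ρ / √(n : ℝ) with hh
  have hh0 : 0 < h := by positivity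
  set y := gridPt h x with hy
  set T := Finset.univ.filter fun i => s ^ 2 ≤ rowVar a y i with hT
  have hy1 : ∑ j, y j ^ 2 ≤ 1 := (sum_sq_gridPt_le hh0 x).trans hx.le
  have hy4 : 1 / 4 ≤ ∑ j, y j ^ 2 := by
    have h1 : ∑ j, x j ^ 2 ≤ 2 * ∑ j, y j ^ 2 + 2 * ∑ j, (x j - y j) ^ 2 := by
      rw [Finset.mul_sum, Finset.mul_sum, ← Finset.sum_add_distrib]
      exact Finset.sum_le_sum fun j _ => by nlinarith [sq_nonneg (x j - 2 * y j)]
    have h2 := sum_sq_sub_gridPt_le hh0 x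
    have h3 : n * h ^ 2 = ρ ^ 2 := by
      rw [hh, div_pow, Real.sq_sqrt hn'.le]; field_simp
    have h4 : ρ ^ 2 ≤ 1 / 4 := by nlinarith
    linarith
  have hTc := card_rowVar_ge hr ha har hdeg hy1 hy4 hδ hs
  have hSc := sub_one_le_card_erase T k
  have hηα' : η * n ≤ α * n := by gcongr
  -- Here `|T| ≥ 4αn`, while there are fewer than `αn` large coordinates and `ηn ≤ αn`; dropping row
  -- `k` costs `1 ≤ ηn`.
  obtain ⟨i, hi, hlt⟩ := exists_rowVar_lt_of_notMem_latticeBad hn hρ hM hbad hx (S := T.erase k)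
    (by
      have : r ^ 2 * δ / 8 * n = 4 * (α * n) := by rw [hα]; ring
      linarith)
    ((Finset.sum_le_sum_of_subset_of_nonneg (Finset.erase_subset_erase _ (Finset.subset_univ _))
      fun _ _ _ => sq_nonneg _).trans hMx)
  exact absurd (Finset.mem_filter.mp (Finset.mem_of_mem_erase hi)).2 (not_le.mpr hlt)

/-- Expansion of the profile forces the number of large coordinates of an almost annihilated
vector to grow when the threshold is lowered. -/
lemma card_bigCoords_expand {n : ℕ} (hn : 0 < n) {a M : Fin n → Fin n → ℝ}
    {r δ κ s ρ ρ' η α L : ℝ} (hr : 0 ≤ r) (hδ : 0 ≤ δ) (hκ : 0 ≤ κ)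
    (har : ∀ i j, a i j ≠ 0 → r ≤ |a i j|)
    (hexp : ∀ J : Finset (Fin n), min ((1 + κ) * (J.card : ℝ)) n ≤
      ((Finset.univ.filter fun i =>
        ⌊δ / 2 * (J.card : ℝ)⌋₊ ≤ (J.filter fun j => a i j ≠ 0).card).card : ℝ))
    (hρ : 0 < ρ) (hρ' : 0 < ρ') (hρρ : ρ' ≤ ρ / 2)
    (hs : s ^ 2 ≤ δ * α * r ^ 2 / 16 * ρ ^ 2)
    (hη1 : η ≤ κ * α / 4) (hη2 : η ≤ δ / 4) (hηn : 1 ≤ η * n) (hαn : 4 ≤ δ * α * n)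
    (hM : NormBounded L M) (hbad : M ∉ latticeBad a s ρ' η L)
    {x : Fin n → ℝ} (hx : ∑ j, x j ^ 2 = 1) (k : Fin n)
    (hMx : ∑ i ∈ Finset.univ.erase k, (∑ j, M i j * x j) ^ 2 ≤ (L / 2 * ρ') ^ 2 * n)
    (hbig : α * n ≤ ((bigCoords ρ x).card : ℝ)) :
    (1 + κ / 2) * ((bigCoords ρ x).card : ℝ) ≤ ((bigCoords ρ' x).card : ℝ) ∨
      (1 - δ / 2) * n ≤ ((bigCoords ρ' x).card : ℝ) := by
  have hn' : (0 : ℝ) < n := by exact_mod_cast hn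
  by_contra! hcon
  obtain ⟨hc1, hc2⟩ := hcon
  set J := bigCoords ρ x with hJ
  set I := Finset.univ.filter fun i =>
        ⌊δ / 2 * (J.card : ℝ)⌋₊ ≤ (J.filter fun j => a i j ≠ 0).card with hI
  have hSc := sub_one_le_card_erase I k
  have hIc := hexp J
  -- The surplus of `I` over the large coordinates is at least `κ|J|/2` or `δn/2`, hence at least
  -- `2ηn`: one `ηn` for the lattice event, one for the deleted row.
  obtain ⟨i, hi, hlt⟩ := exists_rowVar_lt_of_notMem_latticeBad hn hρ' hM hbad hx (S := I.erase k)
    (by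
      have h1 : η * n ≤ κ * α / 4 * n := by gcongr
      have h2 : η * n ≤ δ / 4 * n := by gcongr
      have h3 : κ * (α * n) ≤ κ * J.card := by gcongr
      rcases min_le_iff.mp hIc with h | h <;> nlinarith)
    ((Finset.sum_le_sum_of_subset_of_nonneg (Finset.erase_subset_erase _ (Finset.subset_univ _))
      fun _ _ _ => sq_nonneg _).trans hMx)
  refine absurd hlt (not_lt.mpr ?_)
  have hiI := (Finset.mem_filter.mp (Finset.mem_of_mem_erase hi)).2
  set h : ℝ := ρ / √(n : ℝ) with hh
  have hh0 : 0 < h := by positivity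
  have hh' : ρ' / √(n : ℝ) ≤ h / 2 := by
    rw [hh, div_div, mul_comm, ← div_div]; gcongr
  -- The floor loses at most 1, which `4 ≤ δαn` absorbs by passing from `δ/2` to `δ/4`.
  have hcard : δ / 4 * (α * n) ≤ ((J.filter fun j => a i j ≠ 0).card : ℝ) := by
    have h1 : δ / 2 * (J.card : ℝ) - 1 ≤ (⌊δ / 2 * (J.card : ℝ)⌋₊ : ℝ) :=
      (Nat.sub_one_lt_floor _).le
    have h2 : (⌊δ / 2 * (J.card : ℝ)⌋₊ : ℝ) ≤ ((J.filter fun j => a i j ≠ 0).card : ℝ) := by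
      exact_mod_cast hiI
    have h3 : δ * (α * n) ≤ δ * J.card := by gcongr
    linarith
  calc s ^ 2 ≤ δ * α * r ^ 2 / 16 * ρ ^ 2 := hs
    _ = δ / 4 * (α * n) * (r ^ 2 * (h / 2) ^ 2) := by
        rw [hh, div_pow, div_pow, Real.sq_sqrt hn'.le]; field_simp; ring
    _ ≤ ((J.filter fun j => a i j ≠ 0).card : ℝ) * (r ^ 2 * (h / 2) ^ 2) := by gcongr
    _ = ∑ j ∈ J.filter fun j => a i j ≠ 0, r ^ 2 * (h / 2) ^ 2 := by simp
    -- Rounding at the finer scale moves a coordinate by at most `h/2`, so those in `J` keep size at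
    -- least `h/2`.
    _ ≤ ∑ j ∈ J.filter fun j => a i j ≠ 0, a i j ^ 2 * gridPt (ρ' / √(n : ℝ)) x j ^ 2 := by
        refine Finset.sum_le_sum fun j hj => ?_
        obtain ⟨hjJ, hja⟩ := Finset.mem_filter.mp hj
        have hjx : h ≤ |x j| := (Finset.mem_filter.mp hjJ).2
        have h1 := abs_sub_gridPt_le (h := ρ' / √(n : ℝ)) (by positivity) x j
        have h2 := abs_sub_abs_le_abs_sub (x j) (gridPt (ρ' / √(n : ℝ)) x j)
        rw [← sq_abs (a i j), ← sq_abs (gridPt _ _ _)]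
        gcongr
        · exact har i j hja
        · linarith
    _ ≤ _ := Finset.sum_le_sum_of_subset_of_nonneg (Finset.subset_univ _)
        fun _ _ _ => mul_nonneg (sq_nonneg _) (sq_nonneg _)

/-! ### Near orthogonality of a row to the normals of the others -/

/-- The complement is a countable union of projections of closed sets along the compact factor, and
such projections are closed. -/
lemma measurableSet_forall_imp_le {X Y : Type*} [TopologicalSpace X] [CompactSpace X]
    [TopologicalSpace Y] [MeasurableSpace Y] [BorelSpace Y] {F : Set (X × Y)} (hF : IsClosed F)
    {g : X × Y → ℝ} (hg : Continuous g) (τ : ℝ) :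
    MeasurableSet {y | ∀ x, (x, y) ∈ F → g (x, y) ≤ τ} := by
  have h : {y | ∀ x, (x, y) ∈ F → g (x, y) ≤ τ}ᶜ =
      ⋃ m : ℕ, Prod.snd '' (F ∩ {p | τ + 1 / ((m : ℝ) + 1) ≤ g p}) := by
    ext y
    simp only [Set.mem_compl_iff, Set.mem_ofPred_eq, not_forall, not_le, Set.mem_iUnion,
      Set.mem_image, Set.mem_inter_iff, Prod.exists, exists_prop, exists_eq_right]
    constructor
    · rintro ⟨x, hx, hlt⟩
      obtain ⟨m, hm⟩ := exists_nat_one_div_lt (sub_pos.mpr hlt)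
      exact ⟨m, x, hx, by linarith⟩
    · rintro ⟨m, x, hx, hle⟩
      have : (0 : ℝ) < 1 / ((m : ℝ) + 1) := by positivity
      exact ⟨x, hx, by linarith⟩
  rw [← MeasurableSet.compl_iff, h]
  exact MeasurableSet.iUnion fun m => (isClosedMap_snd_of_compactSpace _
    (hF.inter (isClosed_le continuous_const hg))).measurableSet

/-- Replacing row `k` by zero makes the matrix singular; a normalised kernel vector works and does
not involve row `k`. -/
lemma exists_unit_orthogonal_rows {n : ℕ} (M : Fin n → Fin n → ℝ) (k : Fin n) :
    ∃ ν : Metric.sphere (0 : EuclideanSpace ℝ (Fin n)) 1,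
      ∀ i, i ≠ k → ∑ j, M i j * ν.1 j = 0 := by
  set A : Matrix (Fin n) (Fin n) ℝ := Matrix.of (Function.update M k 0) with hA
  have hdet : A.det = 0 := Matrix.det_eq_zero_of_row_eq_zero k fun j => by simp [hA]
  obtain ⟨v, hv0, hv⟩ := Matrix.exists_mulVec_eq_zero_iff.mpr hdet
  set w : EuclideanSpace ℝ (Fin n) := WithLp.toLp 2 v
  have hw : w ≠ 0 := by
    intro h
    exact hv0 (by simpa [w] using h)
  refine ⟨⟨(‖w‖⁻¹ : ℝ) • w, ?_⟩, fun i hi => ?_⟩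
  · rw [mem_sphere_zero_iff_norm, norm_smul, norm_inv, norm_norm,
      inv_mul_cancel₀ (norm_ne_zero_iff.mpr hw)]
  · have h1 := congrFun hv i
    simp only [Matrix.mulVec, dotProduct, hA, Matrix.of_apply, Function.update_of_ne hi,
      Pi.zero_apply] at h1
    have h2 : ∀ j, M i j * ((‖w‖⁻¹ : ℝ) • w) j = ‖w‖⁻¹ * (M i j * v j) := fun j => by
      simp [w]; ring
    simp only [h2]
    rw [← Finset.mul_sum, h1, mul_zero]

/-- The event that every unit normal to the rows other than `k` is spread with respect to the
profile of row `k` and nearly orthogonal to row `k`. -/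
def nearNormal {n : ℕ} (a : Fin n → Fin n → ℝ) (σ τ : ℝ) (k : Fin n) : Set (Fin n → Fin n → ℝ) :=
  {M | ∀ ν : Metric.sphere (0 : EuclideanSpace ℝ (Fin n)) 1,
    (∀ i, i ≠ k → ∑ j, M i j * ν.1 j = 0) →
      σ ^ 2 ≤ rowVar a ν.1 k ∧ |∑ j, M k j * ν.1 j| ≤ τ}

lemma measurableSet_nearNormal {n : ℕ} (a : Fin n → Fin n → ℝ) (σ τ : ℝ) (k : Fin n) :
    MeasurableSet (nearNormal a σ τ k) := by
  set F : Set (Metric.sphere (0 : EuclideanSpace ℝ (Fin n)) 1 × (Fin n → Fin n → ℝ)) :=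
    {p | ∀ i, i ≠ k → ∑ j, p.2 i j * p.1.1 j = 0} with hF
  have hFc : IsClosed F := by
    have : F = ⋂ i, ⋂ (_ : i ≠ k), {p | ∑ j, p.2 i j * p.1.1 j = 0} := by
      ext p; simp [hF]
    rw [this]
    exact isClosed_iInter fun i => isClosed_iInter fun _ =>
      isClosed_eq (by fun_prop) continuous_const
  have h1 := measurableSet_forall_imp_le hFc (g := fun p => -rowVar a p.1.1 k)
    (by unfold rowVar; fun_prop) (-σ ^ 2)
  have h2 := measurableSet_forall_imp_le hFc (g := fun p => |∑ j, p.2 k j * p.1.1 j|)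
    (by fun_prop) τ
  convert h1.inter h2 using 1
  ext M
  simp only [nearNormal, Set.mem_ofPred_eq, Set.mem_inter_iff, hF, neg_le_neg_iff]
  exact ⟨fun h => ⟨fun ν hν => (h ν hν).1, fun ν hν => (h ν hν).2⟩,
    fun h ν hν => ⟨h.1 ν hν, h.2 ν hν⟩⟩

lemma pi_gaussianReal_linearForm_le {n : ℕ} (m α ν : Fin n → ℝ) {σ τ : ℝ} (hσ : 0 < σ)
    (hτ : 0 < τ) (hv : σ ^ 2 ≤ ∑ j, α j ^ 2 * ν j ^ 2) :
    (Measure.pi fun j => gaussianReal (m j) (sqNN (α j))) {x | |∑ j, x j * ν j| ≤ τ} ≤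
      ENNReal.ofReal (Real.exp 1 * (τ / σ)) := by
  have h0 : {x : Fin n → ℝ | |∑ j, x j * ν j| ≤ τ} =
      (fun x : Fin n → ℝ => ∑ j, x j * ν j) ⁻¹' {u | |u| ≤ τ} := rfl
  have hmeas : MeasurableSet {u : ℝ | |u| ≤ τ} :=
    (isClosed_le continuous_abs continuous_const).measurableSet
  rw [h0, ← Measure.map_apply (by fun_prop) hmeas, map_linearForm_pi_gaussianReal]
  set γ := gaussianReal (∑ j, m j * ν j) (∑ j, sqNN (α j) * sqNN (ν j)) with hγ
  have hsub : {u : ℝ | |u| ≤ τ} ⊆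
      {u | ENNReal.ofReal (Real.exp (-1)) ≤ ENNReal.ofReal (Real.exp (-(u ^ 2 / τ ^ 2)))} := by
    intro u hu
    simp only [Set.mem_ofPred_eq] at hu ⊢
    apply ENNReal.ofReal_le_ofReal
    apply Real.exp_le_exp.mpr
    rw [neg_le_neg_iff, div_le_one (by positivity), ← sq_abs u]
    gcongr
  refine (measure_mono hsub).trans ((meas_ge_le_lintegral_div (by fun_prop)
    (by simp [Real.exp_pos]) ENNReal.ofReal_ne_top).trans ?_)
  have h1 := lintegral_exp_neg_sq_gaussianReal_le (∑ j, m j * ν j)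
    (∑ j, sqNN (α j) * sqNN (ν j)) (s := σ) (ε := τ) hσ (by simpa using hv) hτ
  refine (ENNReal.div_le_div_right h1 _).trans ?_
  rw [← ENNReal.ofReal_div_of_pos (Real.exp_pos _)]
  apply ENNReal.ofReal_le_ofReal
  rw [Real.exp_neg, div_inv_eq_mul, mul_comm]

/-- Fubini: freeze all rows but `k`, so that one normal `ν` serves the whole slice. Since the event
quantifies over all normals, no measurable choice of `ν` is needed. -/
lemma gaussMat_nearNormal {n : ℕ} (b a : Fin n → Fin n → ℝ) {σ τ : ℝ} (hσ : 0 < σ) (hτ : 0 < τ)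
    (k : Fin n) :
    gaussMat b a (nearNormal a σ τ k) ≤ ENNReal.ofReal (Real.exp 1 * (τ / σ)) := by
  set T := nearNormal a σ τ k with hT
  have hTm : MeasurableSet T := measurableSet_nearNormal a σ τ k
  set R : Fin n → Measure (Fin n → ℝ) := fun i =>
    Measure.pi fun j => gaussianReal (b i j) (sqNN (a i j)) with hR
  have hf : Measurable (T.indicator (1 : (Fin n → Fin n → ℝ) → ENNReal)) :=
    measurable_one.indicator hTm
  have hslice : ∀ M : Fin n → Fin n → ℝ,
      ∫⁻ x, T.indicator (1 : (Fin n → Fin n → ℝ) → ENNReal) (Function.update M k x) ∂(R k) ≤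
        ENNReal.ofReal (Real.exp 1 * (τ / σ)) := by
    intro M
    have hm : MeasurableSet (Function.update M k ⁻¹' T) := measurable_update M hTm
    have h1 : ∫⁻ x, T.indicator (1 : (Fin n → Fin n → ℝ) → ENNReal) (Function.update M k x) ∂(R k) =
        R k (Function.update M k ⁻¹' T) := by
      rw [← lintegral_indicator_one hm]; rfl
    rw [h1]
    obtain ⟨ν, hν⟩ := exists_unit_orthogonal_rows M k
    have hν' : ∀ x, ∀ i, i ≠ k → ∑ j, Function.update M k x i j * ν.1 j = 0 := fun x i hi => by
      rw [Function.update_of_ne hi]; exact hν i hi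
    rcases (Function.update M k ⁻¹' T).eq_empty_or_nonempty with h | ⟨x₀, hx₀⟩
    · rw [h]; simp
    -- The variance of the form given by `ν` does not involve row `k`, so a single point `x₀` of the
    -- slice supplies its lower bound for the whole slice.
    · refine (measure_mono fun x hx => ?_).trans
        (pi_gaussianReal_linearForm_le (b k) (a k) ν.1 hσ hτ (hx₀ ν (hν' x₀)).1)
      have := (hx ν (hν' x)).2
      rwa [Function.update_self] at this
  calc gaussMat b a T = ∫⁻ M, T.indicator 1 M ∂Measure.pi R := (lintegral_indicator_one hTm).symm
    _ = lmarginal R Finset.univ (T.indicator 1) 0 := lintegral_eq_lmarginal_univ 0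
    _ = lmarginal R (Finset.univ.erase k)
          (fun M => ∫⁻ x, T.indicator 1 (Function.update M k x) ∂(R k)) 0 :=
        congrFun (lmarginal_erase' _ hf (Finset.mem_univ k)) 0
    _ ≤ lmarginal R (Finset.univ.erase k) (fun _ => ENNReal.ofReal (Real.exp 1 * (τ / σ))) 0 :=
        lmarginal_mono hslice 0
    _ = _ := by simp [lmarginal]

/-- A normalised eigenvector of the adjoint composed with the operator; `0 < n` keeps the index `n -
1` below the dimension. -/
lemma exists_unit_sum_sq_mulVec_le {n : ℕ} (hn : 0 < n) (W : Matrix (Fin n) (Fin n) ℝ) :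
    ∃ x : Fin n → ℝ, ∑ j, x j ^ 2 = 1 ∧
      ∑ i, (∑ j, W i j * x j) ^ 2 = smallestSingularValue W ^ 2 := by
  set T := Matrix.toEuclideanLin W with hT
  have hfr : n - 1 < Module.finrank ℝ (EuclideanSpace ℝ (Fin n)) := by
    rw [finrank_euclideanSpace_fin]; omega
  obtain ⟨v, hv⟩ := (T.hasEigenvalue_adjoint_comp_self_sq_singularValues hfr).exists_hasEigenvector
  have hv0 : ‖v‖ ≠ 0 := norm_ne_zero_iff.mpr hv.2
  have h1 : ‖T v‖ ^ 2 = smallestSingularValue W ^ 2 * ‖v‖ ^ 2 := by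
    have h2 := hv.apply_eq_smul
    rw [← real_inner_self_eq_norm_sq, ← real_inner_self_eq_norm_sq,
      ← LinearMap.adjoint_inner_left, ← LinearMap.comp_apply, h2, real_inner_smul_left]
    rfl
  have h3 : ‖T v‖ ^ 2 = ∑ i, (∑ j, W i j * v j) ^ 2 := by
    rw [EuclideanSpace.real_norm_sq_eq]; rfl
  refine ⟨fun j => v j / ‖v‖, ?_, ?_⟩
  · simp only [div_pow]
    rw [← Finset.sum_div, ← EuclideanSpace.real_norm_sq_eq, div_self (pow_ne_zero 2 hv0)]
  · have h4 : ∀ i, (∑ j, W i j * (v j / ‖v‖)) ^ 2 = (∑ j, W i j * v j) ^ 2 / ‖v‖ ^ 2 := by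
      intro i
      rw [← div_pow, Finset.sum_div]
      congr 1
      exact Finset.sum_congr rfl fun j _ => by ring
    simp only [h4]
    rw [← Finset.sum_div, ← h3, h1, mul_div_assoc, div_self (pow_ne_zero 2 hv0), mul_one]

/-! ### The cascade of scales -/

/-- The exponent of the vector threshold attached to the exponent `q` of the variance threshold. -/
noncomputable def rhoExp (η q : ℝ) : ℝ := 1 + q + (2 + q) / η

/-- The successive exponents of the variance thresholds. -/
noncomputable def varExp (η : ℝ) : ℕ → ℝ
  | 0 => 1
  | k + 1 => rhoExp η (varExp η k) + 1

lemma rhoExp_ge {η q : ℝ} (hη : 0 < η) (hq : 0 ≤ q) : 1 + q ≤ rhoExp η q := by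
  have : 0 ≤ (2 + q) / η := by positivity
  unfold rhoExp; linarith

lemma varExp_ge_one {η : ℝ} (hη : 0 < η) (k : ℕ) : 1 ≤ varExp η k := by
  induction k with
  | zero => exact le_rfl
  | succ k ih =>
    have := rhoExp_ge hη (by linarith : 0 ≤ varExp η k)
    simp only [varExp]; linarith

/-- The `k`-th bad lattice event. -/
def stageBad {n : ℕ} (a : Fin n → Fin n → ℝ) (η L : ℝ) (k : ℕ) : Set (Fin n → Fin n → ℝ) :=
  latticeBad a (L ^ (-varExp η k)) (L ^ (-rhoExp η (varExp η k))) η L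

lemma gaussMat_stageBad {n : ℕ} (b a : Fin n → Fin n → ℝ) {η L : ℝ} (hη : 0 < η)
    (hL : 16 * Real.exp 4 ≤ L) (k : ℕ) :
    (gaussMat b a).real (stageBad a η L k) ≤ Real.exp (-2 * n) :=
  gaussMat_latticeBad_rpow b a (by linarith [varExp_ge_one hη k]) hη hL

lemma two_le_of_exp_le {L : ℝ} (hL : 16 * Real.exp 4 ≤ L) : 2 ≤ L := by
  have := Real.one_le_exp (show (0 : ℝ) ≤ 4 by norm_num)
  linarith

lemma rpow_neg_rhoExp_le_half {η q L : ℝ} (hη : 0 < η) (hq : 0 ≤ q) (hL : 2 ≤ L) :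
    L ^ (-rhoExp η q) ≤ 1 / 2 := by
  calc L ^ (-rhoExp η q) ≤ L ^ (-1 : ℝ) :=
        Real.rpow_le_rpow_of_exponent_le (by linarith) (by linarith [rhoExp_ge hη hq])
    _ = 1 / L := by rw [Real.rpow_neg_one, one_div]
    _ ≤ _ := by gcongr

/-- A unit vector almost annihilated by a matrix outside the first bad event has many
large coordinates. -/
lemma le_card_bigCoords_of_notMem_stageBad {n : ℕ} (hn : 0 < n) {a M : Fin n → Fin n → ℝ}
    {r δ η α L : ℝ} (hr : 0 < r) (hδ : 0 < δ) (hη : 0 < η)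
    (ha : ∀ i j, |a i j| ≤ 1) (har : ∀ i j, a i j ≠ 0 → r ≤ |a i j|)
    (hdeg : ∀ j, δ * n ≤ ((Finset.univ.filter fun i => a i j ≠ 0).card : ℝ))
    (hα : α = r ^ 2 * δ / 32) (hα1 : α ≤ 1) (hηα : η ≤ α) (hηn : 1 ≤ η * n)
    (hL : 16 * Real.exp 4 ≤ L) (hL2 : 16 ≤ r ^ 2 * δ * α * L ^ 2)
    (hM : NormBounded L M) (hbad : M ∉ stageBad a η L 0)
    {x : Fin n → ℝ} (hx : ∑ j, x j ^ 2 = 1) (k : Fin n)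
    (hMx : ∑ i ∈ Finset.univ.erase k, (∑ j, M i j * x j) ^ 2 ≤
      (L / 2 * L ^ (-rhoExp η (varExp η 0))) ^ 2 * n) :
    α * n ≤ ((bigCoords (L ^ (-rhoExp η (varExp η 0))) x).card : ℝ) := by
  have hL' := two_le_of_exp_le hL
  have hL0 : 0 < L := by linarith
  refine le_card_bigCoords_of_degree hn hr.le hδ.le ha har hdeg ?_ hα hηα hηn (by positivity)
    (rpow_neg_rhoExp_le_half hη zero_le_one hL') hM hbad hx k hMx
  have h1 : (L ^ (-varExp η 0)) ^ 2 = 1 / L ^ 2 := by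
    simp only [varExp]
    rw [Real.rpow_neg_one, inv_pow, one_div]
  rw [h1, div_le_iff₀ (by positivity)]
  have : r ^ 2 * δ * α * L ^ 2 ≤ r ^ 2 * δ * 1 * L ^ 2 := by gcongr
  linarith

/-- Outside the bad events, unit vectors orthogonal to all rows but one are spread. -/
lemma card_bigCoords_of_notMem_stageBad {n : ℕ} (hn : 0 < n) {a M : Fin n → Fin n → ℝ}
    {r δ κ η α L : ℝ} (hr : 0 < r) (hδ : 0 < δ) (hκ : 0 < κ) (hη : 0 < η)
    (ha : ∀ i j, |a i j| ≤ 1) (har : ∀ i j, a i j ≠ 0 → r ≤ |a i j|)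
    (hdeg : ∀ j, δ * n ≤ ((Finset.univ.filter fun i => a i j ≠ 0).card : ℝ))
    (hexp : ∀ J : Finset (Fin n), min ((1 + κ) * (J.card : ℝ)) n ≤
      ((Finset.univ.filter fun i =>
        ⌊δ / 2 * (J.card : ℝ)⌋₊ ≤ (J.filter fun j => a i j ≠ 0).card).card : ℝ))
    (hα : α = r ^ 2 * δ / 32) (hα1 : α ≤ 1) (hηα : η ≤ α)
    (hη1 : η ≤ κ * α / 4) (hη2 : η ≤ δ / 4) (hηn : 1 ≤ η * n) (hαn : 4 ≤ δ * α * n)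
    (hL : 16 * Real.exp 4 ≤ L) (hL2 : 16 ≤ r ^ 2 * δ * α * L ^ 2)
    (hM : NormBounded L M) {x : Fin n → ℝ} (hx : ∑ j, x j ^ 2 = 1) (k : Fin n)
    (hMx : ∀ i, i ≠ k → ∑ j, M i j * x j = 0) (m : ℕ)
    (hbad : ∀ l ≤ m, M ∉ stageBad a η L l) :
    min ((1 + κ / 2) ^ m * (α * n)) ((1 - δ / 2) * n) ≤
      ((bigCoords (L ^ (-rhoExp η (varExp η m))) x).card : ℝ) := by
  have hL' := two_le_of_exp_le hL
  have hL0 : 0 < L := by linarith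
  have hα0 : 0 < α := by rw [hα]; positivity
  have hsum : ∀ ρ : ℝ, ∑ i ∈ Finset.univ.erase k, (∑ j, M i j * x j) ^ 2 ≤ (L / 2 * ρ) ^ 2 * n := by
    intro ρ
    rw [Finset.sum_eq_zero fun i hi => by rw [hMx i (Finset.ne_of_mem_erase hi)]; norm_num]
    positivity
  -- The second bound is carried along because `card_bigCoords_expand` requires it at every scale.
  have key : ∀ l ≤ m, min ((1 + κ / 2) ^ l * (α * n)) ((1 - δ / 2) * n) ≤
      ((bigCoords (L ^ (-rhoExp η (varExp η l))) x).card : ℝ) ∧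
      α * n ≤ ((bigCoords (L ^ (-rhoExp η (varExp η l))) x).card : ℝ) := by
    intro l
    induction l with
    | zero =>
      intro hl
      have := le_card_bigCoords_of_notMem_stageBad hn hr hδ hη ha har hdeg hα hα1 hηα hηn hL hL2 hM
        (hbad 0 hl) hx k (hsum _)
      exact ⟨(min_le_left _ _).trans (by simpa using this), this⟩
    | succ l ih =>
      intro hl
      obtain ⟨ih1, ih2⟩ := ih (by omega)
      have hv := varExp_ge_one hη l
      have hρ0 : 0 < L ^ (-rhoExp η (varExp η l)) := by positivity
      -- The next variance threshold is the current vector threshold divided by `L`; this spare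
      -- factor pays for `δ α r² / 16` in `hsq`.
      have hs : L ^ (-varExp η (l + 1)) = L ^ (-rhoExp η (varExp η l)) / L := by
        have : -varExp η (l + 1) = -rhoExp η (varExp η l) - 1 := by simp only [varExp]; ring
        rw [this, Real.rpow_sub hL0, Real.rpow_one]
      have hρρ : L ^ (-rhoExp η (varExp η (l + 1))) ≤ L ^ (-rhoExp η (varExp η l)) / 2 := by
        calc L ^ (-rhoExp η (varExp η (l + 1))) ≤ L ^ (-varExp η (l + 1)) :=
              Real.rpow_le_rpow_of_exponent_le (by linarith)
                (by linarith [rhoExp_ge hη (by linarith [varExp_ge_one hη (l + 1)] :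
                  0 ≤ varExp η (l + 1))])
          _ = L ^ (-rhoExp η (varExp η l)) / L := hs
          _ ≤ _ := by gcongr
      have hmono : bigCoords (L ^ (-rhoExp η (varExp η l))) x ⊆
          bigCoords (L ^ (-rhoExp η (varExp η (l + 1)))) x := by
        intro j hj
        refine Finset.mem_filter.mpr ⟨Finset.mem_univ j, le_trans ?_ (Finset.mem_filter.mp hj).2⟩
        exact div_le_div_of_nonneg_right (by linarith) (Real.sqrt_nonneg _)
      have hmonoc : ((bigCoords (L ^ (-rhoExp η (varExp η l))) x).card : ℝ) ≤
          ((bigCoords (L ^ (-rhoExp η (varExp η (l + 1)))) x).card : ℝ) := by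
        exact_mod_cast Finset.card_le_card hmono
      have hsq : (L ^ (-varExp η (l + 1))) ^ 2 ≤
          δ * α * r ^ 2 / 16 * (L ^ (-rhoExp η (varExp η l))) ^ 2 := by
        rw [hs, div_pow, div_le_iff₀ (by positivity)]
        have : 1 ≤ δ * α * r ^ 2 / 16 * L ^ 2 := by linarith
        nlinarith [sq_nonneg (L ^ (-rhoExp η (varExp η l)))]
      refine ⟨?_, ih2.trans hmonoc⟩
      rcases card_bigCoords_expand hn hr.le hδ.le hκ.le har hexp hρ0 (by positivity) hρρ
        hsq hη1 hη2 hηn hαn hM (hbad (l + 1) hl) hx k (hsum _) ih2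
        with h | h
      · rcases min_le_iff.mp ih1 with h1 | h1
        · refine (min_le_left _ _).trans (le_trans ?_ h)
          rw [pow_succ, mul_comm _ (1 + κ / 2), mul_assoc]
          gcongr
        · exact (min_le_right _ _).trans (h1.trans hmonoc)
      · exact (min_le_right _ _).trans h
  exact (key m le_rfl).1

/-- A spread vector has a large variance on any set of `δ n` entries. -/
lemma le_rowVar_of_spread {n : ℕ} (hn : 0 < n) {a : Fin n → Fin n → ℝ} {r δ ρ : ℝ} (hr : 0 ≤ r)
    (hρ : 0 ≤ ρ) (har : ∀ i j, a i j ≠ 0 → r ≤ |a i j|) (k : Fin n)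
    (hdeg : δ * n ≤ ((Finset.univ.filter fun j => a k j ≠ 0).card : ℝ)) {x : Fin n → ℝ}
    (hbig : (1 - δ / 2) * n ≤ ((bigCoords ρ x).card : ℝ)) :
    r ^ 2 * (δ / 2) * ρ ^ 2 ≤ rowVar a x k := by
  have hn' : (0 : ℝ) < n := by exact_mod_cast hn
  set A := Finset.univ.filter fun j => a k j ≠ 0 with hA
  set B := bigCoords ρ x with hB
  have hcard : δ / 2 * n ≤ ((A ∩ B).card : ℝ) := by
    have h1 : ((A ∪ B).card : ℝ) + ((A ∩ B).card : ℝ) = A.card + B.card := by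
      exact_mod_cast Finset.card_union_add_card_inter A B
    have h2 : ((A ∪ B).card : ℝ) ≤ n := by
      have := Finset.card_le_univ (A ∪ B)
      rw [Fintype.card_fin] at this
      exact_mod_cast this
    linarith
  calc r ^ 2 * (δ / 2) * ρ ^ 2 = δ / 2 * n * (r ^ 2 * (ρ / √(n : ℝ)) ^ 2) := by
        rw [div_pow, Real.sq_sqrt hn'.le]; field_simp
    _ ≤ ((A ∩ B).card : ℝ) * (r ^ 2 * (ρ / √(n : ℝ)) ^ 2) := by gcongr
    _ = ∑ j ∈ A ∩ B, r ^ 2 * (ρ / √(n : ℝ)) ^ 2 := by simp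
    _ ≤ ∑ j ∈ A ∩ B, a k j ^ 2 * x j ^ 2 := by
        refine Finset.sum_le_sum fun j hj => ?_
        obtain ⟨hjA, hjB⟩ := Finset.mem_inter.mp hj
        rw [← sq_abs (a k j), ← sq_abs (x j)]
        gcongr
        · exact har k j (Finset.mem_filter.mp hjA).2
        · exact (Finset.mem_filter.mp hjB).2
    _ ≤ _ := Finset.sum_le_sum_of_subset_of_nonneg (Finset.subset_univ _)
        fun _ _ _ => mul_nonneg (sq_nonneg _) (sq_nonneg _)

/-! ### From normals to the smallest singular value -/

/-- Markov's inequality for the number of occurring near-normality events. -/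
lemma gaussMat_card_nearNormal {n : ℕ} (hn : 0 < n) (b a : Fin n → Fin n → ℝ) {σ τ α t : ℝ}
    (hσ : 0 < σ) (hτ : 0 < τ) (hα : 0 < α) (ht : 0 ≤ t) (h : Real.exp 1 * (τ / σ) ≤ α * t) :
    (gaussMat b a).real {M | α * n ≤ (Set.ncard {k | M ∈ nearNormal a σ τ k} : ℝ)} ≤ t := by
  classical
  have hn' : (0 : ℝ) < n := by exact_mod_cast hn
  set F : (Fin n → Fin n → ℝ) → ENNReal := fun M => ∑ k, (nearNormal a σ τ k).indicator 1 M with hF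
  have hFm : ∀ k, Measurable ((nearNormal a σ τ k).indicator
      (1 : (Fin n → Fin n → ℝ) → ENNReal)) := fun k =>
    measurable_one.indicator (measurableSet_nearNormal a σ τ k)
  have hsub : {M | α * n ≤ (Set.ncard {k | M ∈ nearNormal a σ τ k} : ℝ)} ⊆
      {M | ENNReal.ofReal (α * n) ≤ F M} := by
    intro M hM
    have h1 : F M = ((Set.ncard {k | M ∈ nearNormal a σ τ k} : ℕ) : ENNReal) := by
      simp only [hF, Set.indicator_apply, Pi.one_apply, Finset.sum_boole]
      congr 1
      rw [Set.ncard_eq_toFinset_card']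
      congr 1
      ext k; simp
    simp only [Set.mem_ofPred_eq] at hM ⊢
    rw [h1]
    exact ENNReal.ofReal_le_of_le_toReal (by simpa using hM)
  refine ENNReal.toReal_le_of_le_ofReal ht ((measure_mono hsub).trans
    ((meas_ge_le_lintegral_div (by fun_prop) (by simp; positivity)
      ENNReal.ofReal_ne_top).trans ?_))
  have h1 : ∫⁻ M, F M ∂gaussMat b a ≤ ENNReal.ofReal (n * (α * t)) := by
    rw [hF, lintegral_finsetSum _ fun k _ => hFm k]
    calc ∑ k, ∫⁻ M, (nearNormal a σ τ k).indicator 1 M ∂gaussMat b a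
        ≤ ∑ _k : Fin n, ENNReal.ofReal (α * t) := by
          refine Finset.sum_le_sum fun k _ => ?_
          rw [lintegral_indicator_one (measurableSet_nearNormal a σ τ k)]
          exact (gaussMat_nearNormal b a hσ hτ k).trans (ENNReal.ofReal_le_ofReal h)
      _ = _ := by
          rw [ENNReal.ofReal_mul hn'.le]; simp
  refine (ENNReal.div_le_div_right h1 _).trans ?_
  rw [← ENNReal.ofReal_div_of_pos (by positivity)]
  apply ENNReal.ofReal_le_ofReal
  rw [div_le_iff₀ (by positivity)]
  exact le_of_eq (by ring)

lemma euclideanOpNorm_add_le {n : ℕ} (G H : Matrix (Fin n) (Fin n) ℝ) :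
    euclideanOpNorm (G + H) ≤ euclideanOpNorm G + euclideanOpNorm H := by
  unfold euclideanOpNorm
  rw [map_add]
  exact norm_add_le _ _

lemma normBounded_of_euclideanOpNorm_le {n : ℕ} {L : ℝ} {W : Matrix (Fin n) (Fin n) ℝ}
    (h : euclideanOpNorm W ≤ L / 2 * √(n : ℝ)) : NormBounded L W := by
  intro x
  have := sum_sq_mulVec_le W h x
  rwa [mul_pow, Real.sq_sqrt (Nat.cast_nonneg n)] at this

namespace BipGraph.BroadlyConnected

variable {n : ℕ} {a : Matrix (Fin n) (Fin n) ℝ} {δ κ : ℝ}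

lemma le_card_column (h : (BipGraph.ofMatrix a).BroadlyConnected δ κ) (j : Fin n) :
    δ * n ≤ ((Finset.univ.filter fun i => a i j ≠ 0).card : ℝ) := by
  have := h.rightDegree_ge j
  unfold BipGraph.rightDegree at this
  convert this

lemma le_card_row (h : (BipGraph.ofMatrix a).BroadlyConnected δ κ) (i : Fin n) :
    δ * n ≤ ((Finset.univ.filter fun j => a.transpose j i ≠ 0).card : ℝ) := by
  have := h.leftDegree_ge i
  unfold BipGraph.leftDegree at this
  convert this
  rfl

lemma min_le_card_expansion (h : (BipGraph.ofMatrix a).BroadlyConnected δ κ)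
    (J : Finset (Fin n)) : min ((1 + κ) * (J.card : ℝ)) n ≤
      ((Finset.univ.filter fun i =>
        ⌊δ / 2 * (J.card : ℝ)⌋₊ ≤ (J.filter fun j => a.transpose i j ≠ 0).card).card : ℝ) := by
  have := h.expansion J
  unfold BipGraph.broadNeighbors at this
  convert this
  rfl

end BipGraph.BroadlyConnected

/-- Outside the bad events, a small smallest singular value makes many columns nearly orthogonal
to the normals of the remaining columns. -/
lemma le_ncard_nearNormal {n : ℕ} (hn : 0 < n) {a W : Matrix (Fin n) (Fin n) ℝ}
    {r δ κ η α L : ℝ} {m : ℕ} (hr : 0 < r) (hδ : 0 < δ) (hκ : 0 < κ) (hη : 0 < η)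
    (ha : ∀ i j, |a i j| ≤ 1) (har : ∀ i j, a i j ≠ 0 → r ≤ |a i j|)
    (hΓ : (BipGraph.ofMatrix a).BroadlyConnected δ κ)
    (hα : α = r ^ 2 * δ / 32) (hα1 : α ≤ 1) (hηα : η ≤ α)
    (hη1 : η ≤ κ * α / 4) (hη2 : η ≤ δ / 4) (hηn : 1 ≤ η * n) (hαn : 4 ≤ δ * α * n)
    (hm : 1 ≤ (1 + κ / 2) ^ m * α)
    (hL : 16 * Real.exp 4 ≤ L) (hL2 : 16 ≤ r ^ 2 * δ * α * L ^ 2)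
    (hW : euclideanOpNorm W ≤ L / 2 * √(n : ℝ))
    (hbad : (fun i j => W i j) ∉ stageBad a η L 0)
    (hbadT : ∀ l ≤ m, (fun i j => W j i) ∉ stageBad a.transpose η L l)
    {s : ℝ} (hs0 : 0 ≤ s) (hs : s ≤ L / 2 * L ^ (-rhoExp η (varExp η 0)) * √(n : ℝ))
    (hsing : smallestSingularValue W ≤ s) :
    α * n ≤ (Set.ncard {k | (fun i j => W j i) ∈ nearNormal a.transpose
      (r * √(δ / 2) * L ^ (-rhoExp η (varExp η m)))
      (s * √(n : ℝ) / L ^ (-rhoExp η (varExp η 0))) k} : ℝ) := by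
  have hn' : (0 : ℝ) < n := by exact_mod_cast hn
  have hL0 : 0 < L := by linarith [two_le_of_exp_le hL]
  set ρ₀ := L ^ (-rhoExp η (varExp η 0)) with hρ₀
  have hρ₀0 : 0 < ρ₀ := by positivity
  obtain ⟨x, hx, hWx⟩ := exists_unit_sum_sq_mulVec_le hn W
  have hWs : ∑ i, (∑ j, W i j * x j) ^ 2 ≤ s ^ 2 := by
    rw [hWx]
    exact pow_le_pow_left₀ (LinearMap.singularValues_nonneg _ _) hsing 2
  have hbig : α * n ≤ ((bigCoords ρ₀ x).card : ℝ) := by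
    -- All rows are under control here, so the omitted row is arbitrary. Only column degrees enter
    -- for `x`; expansion is used below for the transpose.
    refine le_card_bigCoords_of_notMem_stageBad hn (M := W) hr hδ hη ha har
      hΓ.le_card_column hα hα1 hηα hηn hL hL2
      (normBounded_of_euclideanOpNorm_le hW) hbad hx ⟨0, hn⟩ ?_
    refine (Finset.sum_le_sum_of_subset_of_nonneg (Finset.subset_univ _)
      fun _ _ _ => sq_nonneg _).trans (hWs.trans ?_)
    calc s ^ 2 ≤ (L / 2 * ρ₀ * √(n : ℝ)) ^ 2 := pow_le_pow_left₀ hs0 hs 2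
      _ = _ := by rw [mul_pow, Real.sq_sqrt hn'.le]
  refine hbig.trans ?_
  rw [← Set.ncard_coe_finset]
  refine Nat.cast_le.mpr (Set.ncard_le_ncard (fun k hk => ?_) (Set.toFinite _))
  intro ν hν
  have hν1 : ∑ j, ν.1 j ^ 2 = 1 := by
    rw [← EuclideanSpace.real_norm_sq_eq, mem_sphere_zero_iff_norm.mp ν.2, one_pow]
  have hspread := card_bigCoords_of_notMem_stageBad hn (a := a.transpose) (M := W.transpose)
    hr hδ hκ hη (fun i j => ha j i) (fun i j => har j i) hΓ.le_card_row hΓ.min_le_card_expansion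
    hα hα1 hηα hη1 hη2 hηn hαn hL hL2
    (normBounded_of_euclideanOpNorm_le (by rwa [euclideanOpNorm_transpose])) hν1 k hν m hbadT
  have hspread' : (1 - δ / 2) * n ≤
      ((bigCoords (L ^ (-rhoExp η (varExp η m))) ν.1).card : ℝ) := by
    refine le_trans (le_min ?_ le_rfl) hspread
    have h1 : (1 - δ / 2) * n ≤ 1 * n := by gcongr; linarith
    have h2 : 1 * (n : ℝ) ≤ (1 + κ / 2) ^ m * α * n := by gcongr
    linarith
  constructor
  · have := le_rowVar_of_spread hn (a := a.transpose) hr.le (by positivity) (fun i j => har j i) k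
      (hΓ.le_card_column k) hspread'
    rw [mul_pow, mul_pow, Real.sq_sqrt (by positivity)]
    exact this
  · have hxk : ρ₀ / √(n : ℝ) ≤ |x k| := (Finset.mem_filter.mp hk).2
    -- Pairing `W x` with `ν` removes every column except the `k`-th.
    have h1 : x k * ∑ j, W j k * ν.1 j = ∑ j, ν.1 j * ∑ i, W j i * x i := by
      have h2 : ∑ j, ν.1 j * ∑ i, W j i * x i = ∑ i, x i * ∑ j, W j i * ν.1 j := by
        simp_rw [Finset.mul_sum]
        rw [Finset.sum_comm]
        exact Finset.sum_congr rfl fun i _ => Finset.sum_congr rfl fun j _ => by ring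
      rw [h2]
      refine (Fintype.sum_eq_single (f := fun i => x i * ∑ j, W j i * ν.1 j) k
        fun i hi => ?_).symm
      have h3 : ∑ j, W j i * ν.1 j = 0 := hν i hi
      simp only [h3, mul_zero]
    have h3 : |x k * ∑ j, W j k * ν.1 j| ≤ s := by
      rw [h1]
      apply abs_le_of_sq_le_sq _ hs0
      refine (Finset.sum_mul_sq_le_sq_mul_sq _ _ _).trans ?_
      rw [hν1, one_mul]
      exact hWs
    rw [abs_mul] at h3
    have h4 : ρ₀ / √(n : ℝ) * |∑ j, W j k * ν.1 j| ≤ s :=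
      (mul_le_mul_of_nonneg_right hxk (abs_nonneg _)).trans h3
    rw [div_mul_eq_mul_div, div_le_iff₀ (by positivity)] at h4
    rw [le_div_iff₀ hρ₀0, mul_comm]
    exact h4

/-- Only an upper bound is needed, so the bad events need not be measurable. -/
lemma HasIndepNormalEntries.measureReal_preimage_le {Ω : Type*} [MeasurableSpace Ω]
    {μ : Measure Ω} {n : ℕ} {W : Ω → Matrix (Fin n) (Fin n) ℝ} {b a : Matrix (Fin n) (Fin n) ℝ}
    (h : HasIndepNormalEntries μ W b a) (B : Set (Fin n → Fin n → ℝ)) :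
    μ.real {ω | (fun i j => W ω i j) ∈ B} ≤ (gaussMat b a).real B := by
  have : IsProbabilityMeasure (gaussMat b a) := isProbabilityMeasure_gaussMat b a
  refine ENNReal.toReal_mono (measure_ne_top _ _) ?_
  rw [← h.map_eq]
  exact Measure.le_map_apply h.aemeasurable B

/-- The probability estimate in terms of the scale parameter `L`. -/
lemma measureReal_smallestSingularValue_le {n : ℕ} (hn : 0 < n) {Ω : Type*} [MeasurableSpace Ω]
    {μ : Measure Ω} [IsProbabilityMeasure μ] {a b : Matrix (Fin n) (Fin n) ℝ}
    {W : Ω → Matrix (Fin n) (Fin n) ℝ} (h : HasIndepNormalEntries μ W b a)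
    {r δ κ η α L : ℝ} {m : ℕ} (hr : 0 < r) (hδ : 0 < δ) (hκ : 0 < κ) (hη : 0 < η)
    (ha : ∀ i j, |a i j| ≤ 1) (har : ∀ i j, a i j ≠ 0 → r ≤ |a i j|)
    (hΓ : (BipGraph.ofMatrix a).BroadlyConnected δ κ)
    (hα : α = r ^ 2 * δ / 32) (hα1 : α ≤ 1) (hηα : η ≤ α)
    (hη1 : η ≤ κ * α / 4) (hη2 : η ≤ δ / 4) (hηn : 1 ≤ η * n) (hαn : 4 ≤ δ * α * n)
    (hm : 1 ≤ (1 + κ / 2) ^ m * α) (hmn : m + 3 ≤ n)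
    (hL : 16 * Real.exp 4 ≤ L) (hL2 : 16 ≤ r ^ 2 * δ * α * L ^ 2)
    (hb : euclideanOpNorm b + 12 * √(n : ℝ) ≤ L / 2 * √(n : ℝ))
    {s t : ℝ} (hs0 : 0 < s) (hs : s ≤ L / 2 * L ^ (-rhoExp η (varExp η 0)) * √(n : ℝ))
    (ht : 0 < t)
    (hst : Real.exp 1 * (s * √(n : ℝ) / L ^ (-rhoExp η (varExp η 0)) /
      (r * √(δ / 2) * L ^ (-rhoExp η (varExp η m)))) ≤ α * t) :
    μ.real {ω | smallestSingularValue (W ω) ≤ s} ≤ t + Real.exp (-n) := by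
  have hn' : (0 : ℝ) < n := by exact_mod_cast hn
  have hL0 : 0 < L := by linarith [two_le_of_exp_le hL]
  have hα0 : 0 < α := by rw [hα]; positivity
  set σ := r * √(δ / 2) * L ^ (-rhoExp η (varExp η m)) with hσ
  set τ := s * √(n : ℝ) / L ^ (-rhoExp η (varExp η 0)) with hτ
  set B₁ : Set (Fin n → Fin n → ℝ) :=
    {M | ¬ euclideanOpNorm (Matrix.of M - Matrix.of b) ≤ 12 * √(n : ℝ)} with hB₁
  set B₂ := stageBad a η L 0 with hB₂
  set B₃ : ℕ → Set (Fin n → Fin n → ℝ) := fun l => stageBad a.transpose η L l with hB₃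
  set B₄ : Set (Fin n → Fin n → ℝ) :=
    {M | α * n ≤ (Set.ncard {k | M ∈ nearNormal a.transpose σ τ k} : ℝ)} with hB₄
  have hsub : {ω | smallestSingularValue (W ω) ≤ s} ⊆
      ({ω | (fun i j => W ω i j) ∈ B₁} ∪ {ω | (fun i j => W ω i j) ∈ B₂}) ∪
      ((⋃ l ∈ Finset.range (m + 1), {ω | (fun i j => (W ω).transpose i j) ∈ B₃ l}) ∪
        {ω | (fun i j => (W ω).transpose i j) ∈ B₄}) := by
    intro ω hω
    by_contra hcon
    simp only [Set.mem_union, not_or, Set.mem_iUnion, not_exists, Finset.mem_range] at hcon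
    obtain ⟨⟨h1, h2⟩, h3, h4⟩ := hcon
    refine h4 (le_ncard_nearNormal hn (W := W ω) hr hδ hκ hη ha har hΓ hα hα1 hηα hη1 hη2 hηn hαn
      hm hL hL2 ?_ h2 (fun l hl => h3 l (by omega)) hs0.le hs hω)
    have h5 : euclideanOpNorm (W ω - b) ≤ 12 * √(n : ℝ) := not_not.mp h1
    have h6 := euclideanOpNorm_add_le (W ω - b) b
    rw [sub_add_cancel] at h6
    linarith
  have e1 : μ.real {ω | (fun i j => W ω i j) ∈ B₁} ≤ Real.exp (-2 * n) :=
    (h.measureReal_preimage_le B₁).trans (gaussMat_opNorm hn b a ha)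
  have e2 : μ.real {ω | (fun i j => W ω i j) ∈ B₂} ≤ Real.exp (-2 * n) :=
    (h.measureReal_preimage_le B₂).trans (gaussMat_stageBad b a hη hL 0)
  have e3 : ∀ l, μ.real {ω | (fun i j => (W ω).transpose i j) ∈ B₃ l} ≤ Real.exp (-2 * n) :=
    fun l => (h.transpose.measureReal_preimage_le (B₃ l)).trans
      (gaussMat_stageBad b.transpose a.transpose hη hL l)
  have e4 : μ.real {ω | (fun i j => (W ω).transpose i j) ∈ B₄} ≤ t :=
    (h.transpose.measureReal_preimage_le B₄).trans
      (gaussMat_card_nearNormal hn b.transpose a.transpose (by positivity) (by positivity) hα0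
        ht.le hst)
  have e3' : μ.real (⋃ l ∈ Finset.range (m + 1),
      {ω | (fun i j => (W ω).transpose i j) ∈ B₃ l}) ≤ (m + 1) * Real.exp (-2 * n) := by
    refine (measureReal_biUnion_finset_le _ _).trans ((Finset.sum_le_sum fun l _ => e3 l).trans ?_)
    simp
  -- There are `m + 3` exceptional events: the norm, one for `W`, and `m + 1` for the transpose.
  have hexp : ((m : ℝ) + 3) * Real.exp (-2 * n) ≤ Real.exp (-n) := by
    have h1 : (m : ℝ) + 3 ≤ Real.exp n := by
      have h2 : (m : ℝ) + 3 ≤ n := by exact_mod_cast hmn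
      linarith [Real.add_one_le_exp (n : ℝ)]
    calc ((m : ℝ) + 3) * Real.exp (-2 * n) ≤ Real.exp n * Real.exp (-2 * n) := by gcongr
      _ = _ := by rw [← Real.exp_add]; congr 1; ring
  calc μ.real {ω | smallestSingularValue (W ω) ≤ s} ≤ _ := measureReal_mono hsub
    _ ≤ _ := measureReal_union_le _ _
    _ ≤ (Real.exp (-2 * n) + Real.exp (-2 * n)) + ((m + 1) * Real.exp (-2 * n) + t) :=
        add_le_add ((measureReal_union_le _ _).trans (add_le_add e1 e2))
          ((measureReal_union_le _ _).trans (add_le_add e3' e4))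
    _ ≤ _ := by linarith

/-! ### Choice of the constants -/

theorem mainTheorem3 (δ κ r : ℝ) (hδ : 0 < δ) (hκ : 0 < κ) (hκδ : κ < δ / 2) (hr : 0 < r) :
    ∃ (c C c' : ℝ) (n₀ : ℕ), 0 < c ∧ 0 < C ∧ 0 < c' ∧
      ∀ (n : ℕ), n₀ ≤ n →
      ∀ (Ω : Type*) [MeasurableSpace Ω] (μ : Measure Ω) [IsProbabilityMeasure μ]
        (a b : Matrix (Fin n) (Fin n) ℝ) (W : Ω → Matrix (Fin n) (Fin n) ℝ),
        HasIndepNormalEntries μ W b a →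
        (∀ i j : Fin n, a i j = 0 ∨ a i j ∈ Set.Icc r 1) →
        (BipGraph.ofMatrix a).BroadlyConnected δ κ →
        ∀ K : ℝ, 1 ≤ K → euclideanOpNorm (matrixExpectation μ W) ≤ K * Real.sqrt (n : ℝ) →
        ∀ t : ℝ, 0 < t →
          μ.real {ω | smallestSingularValue (W ω) ≤
              c * t * K ^ (-C) * (n : ℝ) ^ (-(1 / 2) : ℝ)} ≤
            t + Real.exp (-c' * (n : ℝ)) := by
  -- Capping `r` at 1 is what later yields `α ≤ 1`.
  set r' := min r 1 with hr'
  have hr'0 : 0 < r' := lt_min hr one_pos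
  have hr'1 : r' ≤ 1 := min_le_right _ _
  set α := r' ^ 2 * δ / 32 with hα
  have hα0 : 0 < α := by positivity
  set η := min (min (κ * α / 4) (δ / 4)) α with hη
  have hη0 : 0 < η := by positivity
  -- After `m` expansion rounds `(1 + κ/2)^m αn` exceeds `n`, so the minimum in the spread estimate
  -- is `(1 - δ/2)n`.
  obtain ⟨m, hm⟩ := pow_unbounded_of_one_lt (1 / α) (show 1 < 1 + κ / 2 by linarith)
  -- The three terms serve the lattice bound, the inequality `K + 12 ≤ L₀K/2`, and the variance
  -- comparison between consecutive scales.
  set L₀ : ℝ := 16 * Real.exp 4 + 26 + 16 / (r' ^ 2 * δ * α) with hL₀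
  have hfrac : 0 < 16 / (r' ^ 2 * δ * α) := by positivity
  have hL₀e : 16 * Real.exp 4 ≤ L₀ := by linarith
  have hL₀26 : 26 ≤ L₀ := by linarith [Real.exp_pos 4]
  have hL₀2 : 16 ≤ r' ^ 2 * δ * α * L₀ := by
    have : 16 / (r' ^ 2 * δ * α) ≤ L₀ := by linarith [Real.exp_pos 4]
    rw [div_le_iff₀ (by positivity)] at this
    linarith
  set p₀ := rhoExp η (varExp η 0) with hp₀
  set p₁ := rhoExp η (varExp η m) with hp₁
  have hp₀0 : 0 < p₀ := by
    have h1 := varExp_ge_one hη0 0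
    linarith [rhoExp_ge hη0 (by linarith : 0 ≤ varExp η 0)]
  have hp₁0 : 0 < p₁ := by
    have h1 := varExp_ge_one hη0 m
    linarith [rhoExp_ge hη0 (by linarith : 0 ≤ varExp η m)]
  -- The entry 1 keeps the singular value bound below the spread threshold for `x`; the other makes
  -- each near-normality event have probability at most `αt`.
  set c₁ := min 1 (α * (r' * √(δ / 2)) / Real.exp 1) with hc₁
  have hc₁0 : 0 < c₁ := by positivity
  refine ⟨c₁ * L₀ ^ (-(p₀ + p₁)), p₀ + p₁, 1, m + 3 + ⌈1 / η⌉₊ + ⌈4 / (δ * α)⌉₊,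
    by positivity, by linarith, one_pos, ?_⟩
  intro n hn Ω _ μ _ a b W h haI hΓ K hK hEW t ht
  have hn0 : 0 < n := by omega
  have hn' : (0 : ℝ) < n := by exact_mod_cast hn0
  have hn1 : (1 : ℝ) ≤ n := by exact_mod_cast hn0
  rw [neg_one_mul]
  rcases le_or_gt 1 t with ht1 | ht1
  · exact (measureReal_le_one).trans (by linarith [Real.exp_pos (-(n : ℝ))])
  have ha : ∀ i j, |a i j| ≤ 1 := by
    intro i j
    rcases haI i j with h0 | h0
    · rw [h0]; simp
    · rw [abs_of_nonneg (hr.le.trans h0.1)]; exact h0.2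
  have har : ∀ i j, a i j ≠ 0 → r' ≤ |a i j| := by
    intro i j hij
    rcases haI i j with h0 | h0
    · exact absurd h0 hij
    · exact (min_le_left _ _).trans (h0.1.trans (le_abs_self _))
  -- A degree cannot exceed `n`.
  have hδ1 : δ ≤ 1 := by
    have h1 := hΓ.leftDegree_ge ⟨0, hn0⟩
    have h2 : ((BipGraph.ofMatrix a).leftDegree ⟨0, hn0⟩ : ℝ) ≤ n := by
      refine Nat.cast_le.mpr ((Finset.card_le_univ _).trans_eq (Fintype.card_fin n))
    have h3 : δ * n ≤ 1 * n := by linarith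
    exact le_of_mul_le_mul_right h3 hn'
  have hα1 : α ≤ 1 := by
    have : r' ^ 2 * δ ≤ 1 := mul_le_one₀ (pow_le_one₀ hr'0.le hr'1) hδ.le hδ1
    linarith
  have hηn : 1 ≤ η * n := by
    have h1 : (1 / η) ≤ n := (Nat.le_ceil _).trans (by exact_mod_cast (by omega))
    rwa [div_le_iff₀ hη0, mul_comm] at h1
  have hαn : 4 ≤ δ * α * n := by
    have h1 : 4 / (δ * α) ≤ n := (Nat.le_ceil _).trans (by exact_mod_cast (by omega))
    rwa [div_le_iff₀ (by positivity), mul_comm] at h1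
  set L := L₀ * K with hL
  have hL₀L : L₀ ≤ L := le_mul_of_one_le_right (by linarith) hK
  have hL1 : 1 ≤ L := by linarith
  have hL0 : 0 < L := by linarith
  have hLL : L₀ ≤ L ^ 2 := by nlinarith
  have hsqrt : 1 ≤ √(n : ℝ) := Real.one_le_sqrt.mpr hn1
  -- Since `L = L₀K`, the powers of `L₀` and `K` merge into the two thresholds: `L^(-p₀)` for `x`
  -- and `L^(-p₁)` for the normals.
  have hs : c₁ * L₀ ^ (-(p₀ + p₁)) * t * K ^ (-(p₀ + p₁)) * (n : ℝ) ^ (-(1 / 2) : ℝ) =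
      c₁ * t * (L ^ (-p₀) * L ^ (-p₁)) / √(n : ℝ) := by
    rw [Real.sqrt_eq_rpow, Real.rpow_neg hn'.le, ← Real.rpow_add hL0, hL,
      show -p₀ + -p₁ = -(p₀ + p₁) by ring, Real.mul_rpow (by linarith) (by linarith)]
    ring
  rw [hs]
  have hp₀le : 0 < L ^ (-p₀) := by positivity
  have hp₁le : L ^ (-p₁) ≤ 1 := Real.rpow_le_one_of_one_le_of_nonpos hL1 (by linarith)
  refine measureReal_smallestSingularValue_le hn0 h (m := m) hr'0 hδ hκ hη0 ha har hΓ hα hα1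
    (min_le_right _ _) ((min_le_left _ _).trans (min_le_left _ _))
    ((min_le_left _ _).trans (min_le_right _ _)) hηn hαn ?_ (by omega) (hL₀e.trans hL₀L)
    (hL₀2.trans ?_) ?_ (by positivity) ?_ ht ?_
  · rw [div_lt_iff₀ hα0] at hm
    exact hm.le
  · gcongr
  · rw [h.matrixExpectation_eq] at hEW
    have : K + 12 ≤ L / 2 := by nlinarith
    calc euclideanOpNorm b + 12 * √(n : ℝ) ≤ (K + 12) * √(n : ℝ) := by linarith
      _ ≤ _ := by gcongr
  · rw [div_le_iff₀ (by positivity)]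
    calc c₁ * t * (L ^ (-p₀) * L ^ (-p₁)) ≤ 1 * 1 * (L ^ (-p₀) * 1) := by
          gcongr
          exact min_le_left _ _
      _ = 1 * L ^ (-p₀) * 1 * 1 := by ring
      _ ≤ L / 2 * L ^ (-p₀) * √(n : ℝ) * √(n : ℝ) := by
          gcongr
          linarith
  · have hc₁' : c₁ * Real.exp 1 ≤ α * (r' * √(δ / 2)) := by
      rw [← le_div_iff₀ (Real.exp_pos _)]; exact min_le_right _ _
    have hd : 0 < r' * √(δ / 2) := by positivity
    have : Real.exp 1 * (c₁ * t * (L ^ (-p₀) * L ^ (-p₁)) / √(n : ℝ) * √(n : ℝ) / L ^ (-p₀) /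
        (r' * √(δ / 2) * L ^ (-p₁))) = c₁ * Real.exp 1 * t / (r' * √(δ / 2)) := by
      have : 0 < L ^ (-p₁) := by positivity
      field_simp
    rw [this, div_le_iff₀ hd]
    calc c₁ * Real.exp 1 * t ≤ α * (r' * √(δ / 2)) * t := by gcongr
      _ = _ := by ring
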